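/- Let $\Omega\subset\mathbb{R}^n$, $n\ge 2$, be a connected bounded open Lipschitz domain, let $f\in L^2(\Omega)$, $0<\underline\kappa<\overline\kappa<\infty$ and $\gamma\in(\underline\kappa,\overline\kappa)$. Let $\mathbb{A}$ be the set of all $\kappa\in L^\infty(\Omega)$ with $\underline\kappa\le\kappa\le\overline\kappa$ a.e. and $\int_\Omega\kappa\,dx\le\gamma|\Omega|$, let $\mathbb{Q}(f)=\{q\in L^2(\Omega;\mathbb{R}^n) : \operatorname{div}q=f\}$ (weak divergence), and put $$I_{\rm loc}(\kappa;q)=\tfrac12\int_\Omega\kappa^{-1}|q|^2\,dx,\qquad d^*=\inf_{(\kappa,q)\in\mathbb{A}\times\mathbb{Q}(f)}I_{\rm loc}(\kappa;q).$$ For $\delta>0$ let $\Omega_\delta=\bigcup_{x\in\Omega}B(x,\delta)$, and let $\omega_\delta:\mathbb{R}^n\to[0,\infty)$ be a measurable radial function supported in $B(0,\delta)$ with $\int_{\mathbb{R}^n}|x|^2\omega_\delta^2(x)\,dx=K_{2,n}^{-1}$, where $K_{2,n}$ is the mean of $|s\cdot e|^2$ over $s\in\mathbb{S}^{n-1}$,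 for any unit vector $e$. For $u\in L^2(\Omega)$, extended by zero outside $\Omega$, put $\mathcal{G}_\delta u(x,x')=[u(x)-u(x')]\omega_\delta(x-x')$. Let $\mathcal{D}_\delta$ be the negative adjoint of the operator $\mathcal{G}_\delta:L^2(\Omega)\to L^2(\Omega_\delta\times\Omega_\delta)$ with domain $\mathbb{U}_{\delta,0}=\{u\in L^2(\Omega):\mathcal{G}_\delta u\in L^2(\Omega_\delta\times\Omega_\delta)\}$; that is, $\mathcal{D}_\delta\ddot p=g\in L^2(\Omega)$ means that $\int_\Omega g v\,dx=-\iint_{\Omega_\delta\times\Omega_\delta}\ddot p\,\mathcal{G}_\delta v\,dx\,dx'$ for all $v\in\mathbb{U}_{\delta,0}$. Let $\mathbb{Q}_\delta(f)=\{\ddot p\in L^2(\Omega_\delta\times\Omega_\delta):\mathcal{D}_\delta\ddot p=f\}$, and let $\mathbb{A}_\delta$ be the set of all $\kappa\in L^\infty(\Omega_\delta)$ with $\kappa|_\Omega\in\mathbb{A}$ and $\underline\kappa\le\kappa\le\overline\kappa$ a.e. on $\Omega_\delta\setminus\Omega$. For $\kappa\in\mathbb{A}_\delta$ write $\ddot\kappa(x,x')=2\kappa(x)\kappa(x')/(\kappa(x)+\kappa(x'))$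 and put $$\hat I(\ddot\kappa;\ddot p)=\tfrac12\iint_{\Omega_\delta\times\Omega_\delta}\ddot\kappa^{-1}(x,x')|\ddot p(x,x')|^2\,dx\,dx',\qquad d^*_\delta=\inf_{(\kappa,\ddot p)\in\mathbb{A}_\delta\times\mathbb{Q}_\delta(f)}\hat I(\ddot\kappa;\ddot p).$$ Let $\bar\delta>0$, $\kappa\in\mathbb{A}_{\bar\delta}$ and $q\in\mathbb{Q}(f)$ be given. Then there are $\ddot p_\delta\in\mathbb{Q}_\delta(f)$, $\delta>0$, such that $$\limsup_{\delta\searrow0}\hat I(\ddot\kappa;\ddot p_\delta)\le I_{\rm loc}(\kappa;q).$$ Moreover, $\limsup_{\delta\searrow0}d^*_\delta\le d^*$. -/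

import Mathlib

open MeasureTheory Filter Topology Set
open scoped ContDiff ENNReal

noncomputable section

namespace NonlocalDesign

/-- The Euclidean space of dimension `n`. -/
abbrev E (n : ℕ) : Type := EuclideanSpace ℝ (Fin n)

variable {n : ℕ}

/-- Near each of its boundary points, `Ω` is the strict epigraph, in the direction of some unit
vector `e`, of a Lipschitz function of the component orthogonal to `e`. -/
def HasLipschitzBoundary (Ω : Set (E n)) : Prop :=
  ∀ x₀ ∈ frontier Ω, ∃ e : E n, ‖e‖ = 1 ∧ ∃ g : E n → ℝ, ∃ L : NNReal, LipschitzWith L g ∧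
    ∃ r > 0, ∀ x ∈ Metric.ball x₀ r,
      (x ∈ Ω ↔ g (x - inner ℝ e x • e) < inner ℝ e x)

/-- Connected (in particular nonempty) bounded open Lipschitz domains. -/
structure IsLipschitzDomain (Ω : Set (E n)) : Prop where
  isOpen : IsOpen Ω
  isConnected : IsConnected Ω
  isBounded : Bornology.IsBounded Ω
  lipschitz : HasLipschitzBoundary Ω

/-! ### The local problem -/

/-- Admissible conductivities with bounds `κmin`, `κmax` and volume fraction `γ`, as functions
of which only the values on `Ω` matter. -/
def Adm (Ω : Set (E n)) (κmin κmax γ : ℝ) : Set (E n → ℝ) :=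
  {κ | MemLp κ ∞ (volume.restrict Ω) ∧
    (∀ᵐ x ∂volume.restrict Ω, κ x ∈ Icc κmin κmax) ∧
    ∫ x in Ω, κ x ≤ γ * volume.real Ω}

/-- `g ∈ L²(Ω)` is the weak divergence of `q ∈ L²(Ω; ℝⁿ)`. -/
def HasWeakDiv (Ω : Set (E n)) (q : E n → E n) (g : E n → ℝ) : Prop :=
  MemLp q 2 (volume.restrict Ω) ∧ MemLp g 2 (volume.restrict Ω) ∧
    ∀ φ : E n → ℝ, ContDiff ℝ ∞ φ → HasCompactSupport φ → tsupport φ ⊆ Ω →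
      ∫ x in Ω, g x * φ x = -∫ x in Ω, inner ℝ (q x) (gradient φ x)

/-- The fluxes `q ∈ H(div, Ω; ℝⁿ)` with `div q = f`. -/
def LocalFlux (Ω : Set (E n)) (f : E n → ℝ) : Set (E n → E n) :=
  {q | HasWeakDiv Ω q f}

/-- The local complementary energy `½ ∫_Ω κ⁻¹ |q|²`. -/
def localEnergy (Ω : Set (E n)) (κ : E n → ℝ) (q : E n → E n) : ℝ :=
  (1 / 2) * ∫ x in Ω, (κ x)⁻¹ * ‖q x‖ ^ 2

/-- The optimal value `d*` of the local dual design problem. -/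
def localValue (Ω : Set (E n)) (κmin κmax γ : ℝ) (f : E n → ℝ) : EReal :=
  ⨅ κ ∈ Adm Ω κmin κmax γ, ⨅ q ∈ LocalFlux Ω f, (localEnergy Ω κ q : EReal)

/-! ### The nonlocal problem

The set `Ω_δ = ⋃ x ∈ Ω, B(x, δ)` is `Metric.thickening δ Ω`. -/

/-- `K_{p,n}`, the mean of `|s · e|ᵖ` over the unit sphere (it is the same for all unit
vectors `e`). -/
def sphereMean (p : ℝ) (e : E n) : ℝ :=
  ((volume : Measure (E n)).toSphere.real univ)⁻¹ *
    ∫ s : Metric.sphere (0 : E n) 1, |inner ℝ (s : E n) e| ^ p ∂(volume : Measure (E n)).toSphere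

/-- `w` is an interaction kernel with horizon `δ`: nonnegative, radial, supported in `B(0, δ)`
and normalised. -/
structure IsKernel (δ : ℝ) (w : E n → ℝ) : Prop where
  aemeasurable : AEMeasurable w
  nonneg : ∀ x, 0 ≤ w x
  radial : ∀ x y, ‖x‖ = ‖y‖ → w x = w y
  support_subset : Function.support w ⊆ Metric.ball 0 δ
  normalized : ∀ e : E n, ‖e‖ = 1 → ∫ x, ‖x‖ ^ 2 * w x ^ 2 = (sphereMean 2 e)⁻¹

/-- Square integrable functions on `Ω_δ × Ω_δ`. -/
def MemL2Pair (Ω : Set (E n)) (δ : ℝ) (p : E n × E n → ℝ) : Prop :=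
  MemLp p 2 (volume.restrict (Metric.thickening δ Ω ×ˢ Metric.thickening δ Ω))

/-- The nonlocal gradient `(x, x') ↦ [u(x) - u(x')] w(x - x')`. -/
def nonlocalGrad (w : E n → ℝ) (u : E n → ℝ) (z : E n × E n) : ℝ :=
  (u z.1 - u z.2) * w (z.1 - z.2)

/-- The domain of the nonlocal gradient: functions in `L²(Ω)`, extended by zero outside `Ω`,
whose nonlocal gradient is in `L²(Ω_δ × Ω_δ)`. -/
def GradDomain (Ω : Set (E n)) (δ : ℝ) (w : E n → ℝ) : Set (E n → ℝ) :=
  {u | MemLp u 2 (volume.restrict Ω) ∧ (∀ x, x ∉ Ω → u x = 0) ∧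
    MemL2Pair Ω δ (nonlocalGrad w u)}

/-- `g ∈ L²(Ω)` is the nonlocal divergence of `p ∈ L²(Ω_δ × Ω_δ)`, where the nonlocal divergence
is the negative adjoint of the nonlocal gradient. -/
def HasNonlocalDiv (Ω : Set (E n)) (δ : ℝ) (w : E n → ℝ) (p : E n × E n → ℝ) (g : E n → ℝ) :
    Prop :=
  MemL2Pair Ω δ p ∧ MemLp g 2 (volume.restrict Ω) ∧
    ∀ v ∈ GradDomain Ω δ w,
      ∫ x in Ω, g x * v x =
        -∫ z in Metric.thickening δ Ω ×ˢ Metric.thickening δ Ω, p z * nonlocalGrad w v z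

/-- The nonlocal fluxes whose nonlocal divergence is `f`. -/
def NonlocalFlux (Ω : Set (E n)) (δ : ℝ) (w : E n → ℝ) (f : E n → ℝ) : Set (E n × E n → ℝ) :=
  {p | HasNonlocalDiv Ω δ w p f}

/-- Admissible conductivities on `Ω_δ`. -/
def NonlocalAdm (Ω : Set (E n)) (δ κmin κmax γ : ℝ) : Set (E n → ℝ) :=
  {κ | MemLp κ ∞ (volume.restrict (Metric.thickening δ Ω)) ∧ κ ∈ Adm Ω κmin κmax γ ∧
    ∀ᵐ x ∂volume.restrict (Metric.thickening δ Ω \ Ω), κ x ∈ Icc κmin κmax}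

/-- The harmonic average of the conductivities at two points. -/
def harmonicAvg (κ : E n → ℝ) (z : E n × E n) : ℝ :=
  2 * κ z.1 * κ z.2 / (κ z.1 + κ z.2)

/-- The nonlocal complementary energy `½ ∫∫ c⁻¹ |p|²` over `Ω_δ × Ω_δ` of a flux `p`, for a
two-point conductivity `c`. -/
def nonlocalEnergy (Ω : Set (E n)) (δ : ℝ) (c : E n × E n → ℝ) (p : E n × E n → ℝ) : ℝ :=
  (1 / 2) * ∫ z in Metric.thickening δ Ω ×ˢ Metric.thickening δ Ω, (c z)⁻¹ * p z ^ 2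

/-- The optimal value `d*_δ` of the nonlocal dual design problem. -/
def nonlocalValue (Ω : Set (E n)) (δ : ℝ) (w : E n → ℝ) (κmin κmax γ : ℝ) (f : E n → ℝ) :
    EReal :=
  ⨅ κ ∈ NonlocalAdm Ω δ κmin κmax γ, ⨅ p ∈ NonlocalFlux Ω δ w f,
    (nonlocalEnergy Ω δ (harmonicAvg κ) p : EReal)

end NonlocalDesign

end

open NonlocalDesign

open MeasureTheory Filter Topology Set
open scoped ContDiff ENNReal

noncomputable section

namespace NonlocalDesign

variable {n : ℕ}

/-! A smooth compactly supported field `Q` induces the nonlocal flux `Q(x) · (x - x') w(x - x')`.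
Everything rests on the isotropy of the kernel, `∫ w² x ⊗ x = Id` (`IsKernel.integral_quadratic`),
which follows from radiality and the normalisation. Tested with the rank-one form `a ⊗ a` it shows
that the energy of this flux is close to the local energy of `Q`; tested with the derivative of `Q`
it shows that the nonlocal divergence is close to `div Q`, with an error `O(δ)` by Taylor expansion
(`abs_integral_fieldFlux_mul_grad_add_le`).

The divergence constraint has to hold exactly. The remaining defect is a functional on the domain of
the nonlocal gradient that is small in the `L²` norm. A nonlocal Poincaré inequality with constant
`diam Ω + δ` bounds it by the norm of the nonlocal gradient, so Hahn–Banach and Riesz give a flux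
that repairs the defect and has small `L²` norm (`exists_corrected_flux`). By Young's inequality it
changes the energy little.

A general `q` is first replaced by a smooth `Q` close to it in `H(div, Ω)`. On a Lipschitz domain
such `Q` come from a partition of unity and mollification with kernels whose centre is shifted so
that only values inside `Ω` are sampled (`exists_smooth_approx`). In the energy, the inverse of the
harmonic average is the mean of the two reciprocals, so no regularity of `κ` is needed; the part
over `Ω_δ \ Ω` vanishes in the limit because the boundary is a null set. -/

/-! ### Second moments of the kernel -/

lemma toSphere_real_univ_pos (hn : n ≠ 0) :
    0 < ((volume : Measure (E n)).toSphere.real univ) := by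
  have : Nonempty (Fin n) := ⟨⟨0, Nat.pos_of_ne_zero hn⟩⟩
  have : Nontrivial (E n) := inferInstance
  have h : (volume : Measure (E n)).toSphere univ ≠ 0 := by
    rw [Measure.toSphere_apply_univ]
    refine mul_ne_zero ?_ ?_
    · simpa using hn
    · exact (Metric.measure_ball_pos volume (0 : E n) one_pos).ne'
  exact ENNReal.toReal_pos h (measure_ne_top _ _)

/-- On the unit sphere the squared coordinates add up to 1 pointwise. -/
lemma sum_sphereMean_two (hn : n ≠ 0) :
    ∑ i : Fin n, sphereMean 2 (EuclideanSpace.single i (1 : ℝ) : E n) = 1 := by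
  have hpos := toSphere_real_univ_pos hn
  unfold sphereMean
  rw [← Finset.mul_sum, ← integral_finsetSum]
  · have : ∀ s : Metric.sphere (0 : E n) 1,
        ∑ i : Fin n, |inner ℝ (s : E n) (EuclideanSpace.single i (1 : ℝ))| ^ (2 : ℝ) = 1 := by
      intro s
      have hs : ‖(s : E n)‖ ^ 2 = 1 := by simp
      rw [EuclideanSpace.norm_sq_eq] at hs
      refine Eq.trans (Finset.sum_congr rfl fun i _ => ?_) hs
      rw [EuclideanSpace.inner_single_right]
      simp
    simp_rw [this]
    simp only [integral_const, smul_eq_mul, mul_one]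
    exact inv_mul_cancel₀ hpos.ne'
  · intro i _
    have hc : Continuous fun s : Metric.sphere (0 : E n) 1 =>
        |inner ℝ (s : E n) (EuclideanSpace.single i (1 : ℝ))| ^ (2 : ℝ) := by
      refine Continuous.rpow_const ?_ (fun _ => Or.inr (by norm_num))
      fun_prop
    exact hc.integrable_of_hasCompactSupport (HasCompactSupport.of_compactSpace _)

/-- The normalisation is imposed for every unit vector, so the `n` coordinate sphere means all equal
the reciprocal of this moment, and they add up to 1. Rotation invariance of the surface measure is
not needed. -/
lemma IsKernel.integral_norm_sq_mul_sq (hn : n ≠ 0) {δ : ℝ} {w : E n → ℝ} (hw : IsKernel δ w) :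
    ∫ x, ‖x‖ ^ 2 * w x ^ 2 = n := by
  have hs := sum_sphereMean_two hn
  have h : ∀ i : Fin n, sphereMean 2 (EuclideanSpace.single i (1 : ℝ) : E n)
      = (∫ x, ‖x‖ ^ 2 * w x ^ 2)⁻¹ := fun i => by
    rw [hw.normalized (EuclideanSpace.single i (1 : ℝ)) (by simp), inv_inv]
  simp_rw [h] at hs
  simp only [Finset.sum_const, Finset.card_univ, Fintype.card_fin, nsmul_eq_mul] at hs
  exact (eq_of_mul_inv_eq_one hs).symm

/-- A function that is not integrable has Bochner integral 0 by convention, but this integral is `n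
≠ 0`. -/
lemma IsKernel.integrable_norm_sq_mul_sq (hn : n ≠ 0) {δ : ℝ} {w : E n → ℝ}
    (hw : IsKernel δ w) : Integrable fun x => ‖x‖ ^ 2 * w x ^ 2 := by
  by_contra h
  have := hw.integral_norm_sq_mul_sq hn
  rw [integral_undef h] at this
  exact hn (by exact_mod_cast this.symm)

lemma IsKernel.lintegral_norm_sq_mul_sq (hn : n ≠ 0) {δ : ℝ} {w : E n → ℝ}
    (hw : IsKernel δ w) : ∫⁻ x, ENNReal.ofReal (‖x‖ ^ 2 * w x ^ 2) = n := by
  rw [← ofReal_integral_eq_lintegral_ofReal (hw.integrable_norm_sq_mul_sq hn)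
    (ae_of_all _ fun x => by positivity), hw.integral_norm_sq_mul_sq hn, ENNReal.ofReal_natCast]

lemma IsKernel.comp_linearIsometryEquiv {δ : ℝ} {w : E n → ℝ} (hw : IsKernel δ w)
    (T : E n ≃ₗᵢ[ℝ] E n) (x : E n) : w (T x) = w x :=
  hw.radial _ _ (T.norm_map x)

lemma IsKernel.integrable_coord_mul (hn : n ≠ 0) {δ : ℝ} {w : E n → ℝ} (hw : IsKernel δ w)
    (i j : Fin n) : Integrable fun x : E n => x i * x j * w x ^ 2 := by
  refine (hw.integrable_norm_sq_mul_sq hn).mono' ?_ (ae_of_all _ fun x => ?_)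
  · have : Continuous fun x : E n => x i * x j := by fun_prop
    exact this.aestronglyMeasurable.mul (hw.aemeasurable.pow_const 2).aestronglyMeasurable
  · rw [Real.norm_eq_abs, abs_mul, abs_mul, abs_of_nonneg (sq_nonneg (w x)), pow_two ‖x‖]
    have hi := PiLp.norm_apply_le x i
    have hj := PiLp.norm_apply_le x j
    rw [Real.norm_eq_abs] at hi hj
    gcongr

/-- The reflection of the `i`-th coordinate preserves the radial kernel and changes the sign of the
integrand. -/
lemma IsKernel.integral_coord_mul_of_ne {δ : ℝ} {w : E n → ℝ} (hw : IsKernel δ w)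
    {i j : Fin n} (hij : i ≠ j) : ∫ x : E n, x i * x j * w x ^ 2 = 0 := by
  let T : E n ≃ₗᵢ[ℝ] E n := LinearIsometryEquiv.piLpCongrRight 2
    (fun k => if k = i then LinearIsometryEquiv.neg ℝ else LinearIsometryEquiv.refl ℝ ℝ)
  have hTi : ∀ x : E n, T x i = - x i := fun x => by simp [T]
  have hTj : ∀ x : E n, T x j = x j := fun x => by simp [T, hij.symm]
  have h := T.measurePreserving.integral_comp T.toHomeomorph.measurableEmbedding
    (fun x : E n => x i * x j * w x ^ 2)
  have h2 : ∀ x : E n, T x i * T x j * w (T x) ^ 2 = -(x i * x j * w x ^ 2) := fun x => by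
    rw [hTi, hTj, hw.comp_linearIsometryEquiv]; ring
  simp_rw [h2] at h
  rw [integral_neg] at h
  linarith

/-- Swapping two coordinates shows that the `n` diagonal moments agree; their sum is `n`. -/
lemma IsKernel.integral_coord_sq (hn : n ≠ 0) {δ : ℝ} {w : E n → ℝ} (hw : IsKernel δ w)
    (i : Fin n) : ∫ x : E n, x i * x i * w x ^ 2 = 1 := by
  have heq : ∀ j : Fin n, ∫ x : E n, x j * x j * w x ^ 2 = ∫ x : E n, x i * x i * w x ^ 2 := by
    intro j
    let T : E n ≃ₗᵢ[ℝ] E n := LinearIsometryEquiv.piLpCongrLeft 2 ℝ ℝ (Equiv.swap i j)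
    have h := T.measurePreserving.integral_comp T.toHomeomorph.measurableEmbedding
      (fun x : E n => x i * x i * w x ^ 2)
    have hT : ∀ x : E n, T x i = x j := fun x => by
      simp [T, LinearIsometryEquiv.piLpCongrLeft_apply, Equiv.piCongrLeft'_apply]
    rw [← h]
    refine integral_congr_ae (ae_of_all _ fun x => ?_)
    simp only [hT, hw.comp_linearIsometryEquiv]
  have hsum : ∑ j : Fin n, ∫ x : E n, x j * x j * w x ^ 2 = n := by
    rw [← integral_finsetSum _ fun j _ => hw.integrable_coord_mul hn j j,
      ← hw.integral_norm_sq_mul_sq hn]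
    refine integral_congr_ae (ae_of_all _ fun x => ?_)
    simp only
    rw [EuclideanSpace.norm_sq_eq, Finset.sum_mul]
    refine Finset.sum_congr rfl fun j _ => ?_
    rw [Real.norm_eq_abs, sq_abs]; ring
  simp_rw [heq] at hsum
  simp only [Finset.sum_const, Finset.card_univ, Fintype.card_fin, nsmul_eq_mul] at hsum
  have : (n : ℝ) ≠ 0 := by exact_mod_cast hn
  exact mul_left_cancel₀ this (by rw [hsum, mul_one])

/-- The trace of a linear map on Euclidean space in terms of coordinates. -/
def tr (A : E n →L[ℝ] E n) : ℝ := ∑ i : Fin n, A (EuclideanSpace.single i 1) i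

lemma inner_self_map_eq_sum (A : E n →L[ℝ] E n) (x : E n) :
    inner ℝ (A x) x = ∑ i : Fin n, ∑ j : Fin n, A (EuclideanSpace.single j 1) i * (x i * x j) := by
  have hx : A x = ∑ j : Fin n, x j • A (EuclideanSpace.single j 1) := by
    conv_lhs => rw [← (EuclideanSpace.basisFun (Fin n) ℝ).sum_repr x]
    simp [map_sum]
  rw [PiLp.inner_apply]
  refine Finset.sum_congr rfl fun i _ => ?_
  rw [hx]
  simp only [WithLp.ofLp_sum, Finset.sum_apply, PiLp.smul_apply, smul_eq_mul,
    RCLike.inner_apply, conj_trivial, Finset.mul_sum]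
  exact Finset.sum_congr rfl fun j _ => by ring

lemma IsKernel.integral_quadratic (hn : n ≠ 0) {δ : ℝ} {w : E n → ℝ} (hw : IsKernel δ w)
    (A : E n →L[ℝ] E n) : ∫ x, w x ^ 2 * inner ℝ (A x) x = tr A := by
  have h : ∀ x : E n, w x ^ 2 * inner ℝ (A x) x =
      ∑ i : Fin n, ∑ j : Fin n, A (EuclideanSpace.single j 1) i * (x i * x j * w x ^ 2) := by
    intro x
    rw [inner_self_map_eq_sum, Finset.mul_sum]
    refine Finset.sum_congr rfl fun i _ => ?_
    rw [Finset.mul_sum]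
    exact Finset.sum_congr rfl fun j _ => by ring
  simp_rw [h]
  have hi := fun i j => (hw.integrable_coord_mul hn i j).const_mul
    (A (EuclideanSpace.single j 1) i)
  rw [integral_finsetSum _ fun i _ => integrable_finsetSum _ fun j _ => hi i j, tr]
  refine Finset.sum_congr rfl fun i _ => ?_
  rw [integral_finsetSum _ fun j _ => hi i j]
  simp_rw [integral_const_mul]
  rw [Finset.sum_eq_single i]
  · rw [hw.integral_coord_sq hn, mul_one]
  · intro j _ hj
    rw [hw.integral_coord_mul_of_ne hj.symm, mul_zero]
  · simp

lemma IsKernel.integrable_quadratic (hn : n ≠ 0) {δ : ℝ} {w : E n → ℝ} (hw : IsKernel δ w)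
    (A : E n →L[ℝ] E n) : Integrable fun x => w x ^ 2 * inner ℝ (A x) x := by
  refine ((hw.integrable_norm_sq_mul_sq hn).const_mul ‖A‖).mono' ?_ (ae_of_all _ fun x => ?_)
  · have : Continuous fun x : E n => inner ℝ (A x) x := by fun_prop
    exact (hw.aemeasurable.pow_const 2).aestronglyMeasurable.mul this.aestronglyMeasurable
  · rw [Real.norm_eq_abs, abs_mul, abs_of_nonneg (sq_nonneg (w x))]
    calc w x ^ 2 * |inner ℝ (A x) x| ≤ w x ^ 2 * (‖A‖ * ‖x‖ * ‖x‖) := by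
          gcongr
          exact (abs_real_inner_le_norm _ _).trans (by gcongr; exact A.le_opNorm x)
      _ = _ := by ring

lemma IsKernel.integral_inner_sq (hn : n ≠ 0) {δ : ℝ} {w : E n → ℝ} (hw : IsKernel δ w)
    (a : E n) : ∫ x, w x ^ 2 * inner ℝ a x ^ 2 = ‖a‖ ^ 2 := by
  have h := hw.integral_quadratic hn ((innerSL ℝ a).smulRight a)
  have h2 : tr ((innerSL ℝ a).smulRight a) = ‖a‖ ^ 2 := by
    rw [EuclideanSpace.norm_sq_eq, tr]
    refine Finset.sum_congr rfl fun i _ => ?_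
    simp [EuclideanSpace.inner_single_right, pow_two]
  rw [← h2, ← h]
  refine integral_congr_ae (ae_of_all _ fun x => ?_)
  simp [inner_smul_left, pow_two]

/-! ### `L²` seminorms and representation of functionals -/

section L2

variable {α F : Type*} [MeasurableSpace α] {μ : Measure α} [NormedAddCommGroup F]

/-- The `L²` seminorm as a real number. -/
def l2norm (μ : Measure α) (f : α → F) : ℝ := (eLpNorm f 2 μ).toReal

lemma l2norm_nonneg (f : α → F) : 0 ≤ l2norm μ f := ENNReal.toReal_nonneg

lemma eLpNorm_two_sq (f : α → F) : eLpNorm f 2 μ ^ 2 = ∫⁻ x, ‖f x‖ₑ ^ 2 ∂μ := by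
  have h := eLpNorm_nnreal_pow_eq_lintegral (μ := μ) (f := f) (p := 2) (by norm_num)
  have h2 : ((2 : NNReal) : ℝ) = ((2 : ℕ) : ℝ) := by norm_num
  rw [h2] at h
  simp only [ENNReal.rpow_natCast] at h
  exact_mod_cast h

lemma l2norm_sq {f : α → F} (hf : MemLp f 2 μ) : l2norm μ f ^ 2 = ∫ x, ‖f x‖ ^ 2 ∂μ := by
  have h := eLpNorm_two_sq (μ := μ) f
  rw [l2norm, ← ENNReal.toReal_pow, h, integral_eq_lintegral_of_nonneg_ae
    (f := fun x => ‖f x‖ ^ 2) (ae_of_all _ fun x => by positivity) (hf.1.norm.pow 2)]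
  congr 1
  refine lintegral_congr fun x => ?_
  rw [ENNReal.ofReal_pow (norm_nonneg _), ofReal_norm]

lemma l2norm_toLp {f : α → F} (hf : MemLp f 2 μ) : ‖hf.toLp f‖ = l2norm μ f :=
  Lp.norm_toLp f hf

lemma inner_toLp_eq_integral_mul {f g : α → ℝ} (hf : MemLp f 2 μ) (hg : MemLp g 2 μ) :
    inner ℝ (hf.toLp f) (hg.toLp g) = ∫ x, f x * g x ∂μ := by
  rw [L2.inner_def]
  refine integral_congr_ae ?_
  filter_upwards [hf.coeFn_toLp, hg.coeFn_toLp] with x h1 h2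
  rw [h1, h2]
  simp [mul_comm]

lemma abs_integral_mul_le_l2norm {f g : α → ℝ} (hf : MemLp f 2 μ) (hg : MemLp g 2 μ) :
    |∫ x, f x * g x ∂μ| ≤ l2norm μ f * l2norm μ g := by
  rw [← inner_toLp_eq_integral_mul hf hg, ← l2norm_toLp hf, ← l2norm_toLp hg]
  exact abs_real_inner_le_norm _ _

/-- The bound forces `L` to factor through `G` as a bounded functional on the range of `G`.
Hahn–Banach extends it to `H` with the same norm and Riesz represents it; the range need not be
closed. -/
lemma exists_inner_eq_of_bound {V H : Type*} [AddCommGroup V] [Module ℝ V]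
    [NormedAddCommGroup H] [InnerProductSpace ℝ H] [CompleteSpace H] (G : V →ₗ[ℝ] H)
    (L : V →ₗ[ℝ] ℝ) {K : ℝ} (hK : 0 ≤ K) (h : ∀ v, |L v| ≤ K * ‖G v‖) :
    ∃ r : H, ‖r‖ ≤ K ∧ ∀ v, inner ℝ r (G v) = L v := by
  obtain ⟨s, hs⟩ := G.rangeRestrict.exists_rightInverse_of_surjective G.range_rangeRestrict
  have hs' : ∀ y : LinearMap.range G, G (s y) = y := fun y =>
    congrArg Subtype.val (LinearMap.congr_fun hs y)
  let ℓ : StrongDual ℝ (LinearMap.range G) := (L ∘ₗ s).mkContinuous K fun y => by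
    have := h (s y)
    rw [hs'] at this
    exact this
  have hℓ : ‖ℓ‖ ≤ K := LinearMap.mkContinuous_norm_le _ hK _
  obtain ⟨g, hg, hgn⟩ := exists_extension_norm_eq (LinearMap.range G) ℓ
  refine ⟨(InnerProductSpace.toDual ℝ H).symm g, ?_, fun v => ?_⟩
  · rw [LinearIsometryEquiv.norm_map, hgn]; exact hℓ
  · rw [InnerProductSpace.toDual_symm_apply]
    have h1 := hg ⟨G v, LinearMap.mem_range_self G v⟩
    rw [h1]
    change L (s ⟨G v, _⟩) = L v
    -- The two preimages `s (G v)` and `v` differ by an element of the kernel of `G`, where the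
    -- bound makes `L` vanish.
    have h2 := h (s ⟨G v, LinearMap.mem_range_self G v⟩ - v)
    rw [map_sub, map_sub, hs', sub_self, norm_zero, mul_zero] at h2
    exact sub_eq_zero.1 (abs_nonpos_iff.1 h2)

end L2

/-! ### The variables `(x, x - x')` and the nonlocal Poincaré inequality -/

lemma measurePreserving_prod_sub :
    MeasurePreserving (fun z : E n × E n => (z.1, z.1 - z.2)) := by
  have h := (measurePreserving_prod_add (volume : Measure (E n)) (volume : Measure (E n))).comp
    ((MeasurePreserving.id (volume : Measure (E n))).prod
      (Measure.measurePreserving_neg (volume : Measure (E n))))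
  have he : (fun z : E n × E n => (z.1, z.1 - z.2))
      = (fun z : E n × E n => (z.1, z.1 + z.2)) ∘ Prod.map id Neg.neg := by
    ext z : 1
    simp [sub_eq_add_neg]
  rw [he]
  exact h

lemma measurableEmbedding_prod_sub :
    MeasurableEmbedding (fun z : E n × E n => (z.1, z.1 - z.2)) :=
  (Homeomorph.mk ⟨fun z : E n × E n => (z.1, z.1 - z.2), fun z => (z.1, z.1 - z.2),
    fun z => by simp, fun z => by simp⟩ (by fun_prop) (by fun_prop)).measurableEmbedding

lemma IsKernel.norm_lt_of_ne_zero {δ : ℝ} {w : E n → ℝ} (hw : IsKernel δ w) {h : E n}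
    (hh : w h ≠ 0) : ‖h‖ < δ := by
  simpa using hw.support_subset hh

section Domain

variable {Ω : Set (E n)} {δ : ℝ} {w v : E n → ℝ}

lemma IsKernel.mul_eq_zero_of_notMem (hw : IsKernel δ w) {z : E n × E n}
    (hz : z ∉ Metric.thickening δ Ω ×ˢ Metric.thickening δ Ω) (h : z.1 ∈ Ω ∨ z.2 ∈ Ω) :
    w (z.1 - z.2) = 0 := by
  by_contra hne
  have hd := hw.norm_lt_of_ne_zero hne
  have hδ : 0 < δ := (norm_nonneg _).trans_lt hd
  refine hz ⟨?_, ?_⟩ <;> rw [Metric.mem_thickening_iff] <;> rcases h with h | h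
  · exact ⟨_, h, by simpa using hδ⟩
  · exact ⟨_, h, by rwa [dist_eq_norm]⟩
  · exact ⟨_, h, by rwa [dist_comm, dist_eq_norm]⟩
  · exact ⟨_, h, by simpa using hδ⟩

/-- If the kernel does not vanish, then two points of which one is in `Ω` both lie in `Ω_δ`. Hence
integrals over `Ω_δ × Ω_δ` can be taken over the whole space, where translations act. -/
lemma nonlocalGrad_eq_zero_of_notMem (hw : IsKernel δ w) (hv : ∀ x, x ∉ Ω → v x = 0)
    {z : E n × E n} (hz : z ∉ Metric.thickening δ Ω ×ˢ Metric.thickening δ Ω) :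
    nonlocalGrad w v z = 0 := by
  unfold nonlocalGrad
  by_cases h : z.1 ∈ Ω ∨ z.2 ∈ Ω
  · rw [hw.mul_eq_zero_of_notMem hz h, mul_zero]
  · rw [not_or] at h
    rw [hv _ h.1, hv _ h.2, sub_self, zero_mul]

lemma measurableSet_thickening_prod :
    MeasurableSet (Metric.thickening δ Ω ×ˢ Metric.thickening δ Ω) :=
  Metric.isOpen_thickening.measurableSet.prod Metric.isOpen_thickening.measurableSet

lemma indicator_nonlocalGrad (hw : IsKernel δ w) (hv : ∀ x, x ∉ Ω → v x = 0) :
    (Metric.thickening δ Ω ×ˢ Metric.thickening δ Ω).indicator (nonlocalGrad w v)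
      = nonlocalGrad w v :=
  Set.indicator_eq_self.2 fun _ hz => by
    by_contra h
    exact hz (nonlocalGrad_eq_zero_of_notMem hw hv h)

lemma memLp_of_mem_gradDomain (hΩ : MeasurableSet Ω) (hv : v ∈ GradDomain Ω δ w) :
    MemLp v 2 := by
  have h := (memLp_indicator_iff_restrict hΩ).2 hv.1
  rwa [Set.indicator_eq_self.2 fun x hx => by
    by_contra h
    exact hx (hv.2.1 x h)] at h

lemma memLp_nonlocalGrad (hw : IsKernel δ w) (hv : v ∈ GradDomain Ω δ w) :
    MemLp (nonlocalGrad w v) 2 := by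
  have h := (memLp_indicator_iff_restrict measurableSet_thickening_prod).2 hv.2.2
  rwa [indicator_nonlocalGrad hw hv.2.1] at h

lemma eLpNorm_nonlocalGrad_restrict (hw : IsKernel δ w) (hv : ∀ x, x ∉ Ω → v x = 0) :
    eLpNorm (nonlocalGrad w v) 2
      (volume.restrict (Metric.thickening δ Ω ×ˢ Metric.thickening δ Ω))
      = eLpNorm (nonlocalGrad w v) 2 volume := by
  rw [← eLpNorm_indicator_eq_eLpNorm_restrict measurableSet_thickening_prod,
    indicator_nonlocalGrad hw hv]

/-- The difference with step `N • h` telescopes into `N` translates of the difference with step `h`.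
-/
lemma eLpNorm_sub_translate_nsmul_le (hv : AEStronglyMeasurable v) (h : E n) (N : ℕ) :
    eLpNorm (fun x => v x - v (x - N • h)) 2 volume
      ≤ N * eLpNorm (fun x => v x - v (x - h)) 2 volume := by
  have hm : ∀ a : E n, MeasurePreserving (fun x : E n => x - a) := fun a =>
    measurePreserving_sub_right volume a
  have hva : ∀ a : E n, AEStronglyMeasurable fun x => v (x - a) := fun a =>
    hv.comp_measurePreserving (hm a)
  induction N with
  | zero => simp
  | succ N ih =>
    have hsplit : (fun x => v x - v (x - (N + 1) • h))
        = (fun x => v x - v (x - h)) + (fun x => v x - v (x - N • h)) ∘ (fun x => x - h) := by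
      ext x
      have : x - (N + 1) • h = x - h - N • h := by rw [add_smul, one_smul]; abel
      simp [this]
    rw [hsplit]
    refine (eLpNorm_add_le (hv.sub (hva h)) ((hv.sub (hva _)).comp_measurePreserving (hm h))
      (by norm_num)).trans ?_
    rw [eLpNorm_comp_measurePreserving (hv.sub (hva _)) (hm h)]
    push_cast
    rw [add_mul, one_mul, add_comm]
    exact add_le_add ih le_rfl

/-- A translation by more than the diameter moves `Ω` off itself, so the difference with such a step
dominates `v` pointwise. It is reached in `N` steps `h` with `N ‖h‖` at most `diam Ω + ‖h‖`. -/
lemma norm_mul_eLpNorm_le (hΩ : Bornology.IsBounded Ω) (hv : AEStronglyMeasurable v)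
    (hv0 : ∀ x, x ∉ Ω → v x = 0) {h : E n} (hδ : ‖h‖ < δ) :
    ENNReal.ofReal ‖h‖ * eLpNorm v 2 volume
      ≤ ENNReal.ofReal (Metric.diam Ω + δ) * eLpNorm (fun x => v x - v (x - h)) 2 volume := by
  rcases eq_or_ne h 0 with rfl | hne
  · simp
  have hpos : 0 < ‖h‖ := norm_pos_iff.2 hne
  set N : ℕ := ⌊Metric.diam Ω / ‖h‖⌋₊ + 1 with hN
  have hD : 0 ≤ Metric.diam Ω := Metric.diam_nonneg
  have hN1 : Metric.diam Ω < N * ‖h‖ := by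
    rw [← div_lt_iff₀ hpos, hN]; push_cast
    exact Nat.lt_floor_add_one _
  have hN2 : N * ‖h‖ ≤ Metric.diam Ω + δ := by
    have := Nat.floor_le (div_nonneg hD hpos.le)
    rw [le_div_iff₀ hpos] at this
    rw [hN]; push_cast
    linarith
  have h1 : eLpNorm v 2 volume ≤ eLpNorm (fun x => v x - v (x - N • h)) 2 volume := by
    refine eLpNorm_mono fun x => ?_
    by_cases hx : x ∈ Ω
    · have : x - N • h ∉ Ω := fun hx' => by
        have := Metric.dist_le_diam_of_mem hΩ hx hx'
        rw [dist_eq_norm, sub_sub_cancel, ← Nat.cast_smul_eq_nsmul ℝ, norm_smul] at this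
        simp at this
        linarith
      rw [hv0 _ this, sub_zero]
    · rw [hv0 _ hx]; simp
  calc ENNReal.ofReal ‖h‖ * eLpNorm v 2 volume
      ≤ ENNReal.ofReal ‖h‖ * (N * eLpNorm (fun x => v x - v (x - h)) 2 volume) := by
        gcongr
        exact h1.trans (eLpNorm_sub_translate_nsmul_le hv h N)
    _ = ENNReal.ofReal (N * ‖h‖) * eLpNorm (fun x => v x - v (x - h)) 2 volume := by
        rw [ENNReal.ofReal_mul (Nat.cast_nonneg _), ENNReal.ofReal_natCast]; ring
    _ ≤ _ := by gcongr

lemma eLpNorm_nonlocalGrad_sq (hw : IsKernel δ w) (hv : AEStronglyMeasurable v) :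
    eLpNorm (nonlocalGrad w v) 2 volume ^ 2
      = ∫⁻ h, ‖w h‖ₑ ^ 2 * eLpNorm (fun x => v x - v (x - h)) 2 volume ^ 2 := by
  have hm : AEMeasurable (fun z : E n × E n => ‖(v z.1 - v (z.1 - z.2)) * w z.2‖ₑ ^ 2) := by
    refine AEMeasurable.pow_const (AEStronglyMeasurable.enorm ?_) 2
    refine AEStronglyMeasurable.mul (AEStronglyMeasurable.sub ?_ ?_) ?_
    · exact hv.comp_quasiMeasurePreserving Measure.quasiMeasurePreserving_fst
    · exact hv.comp_quasiMeasurePreserving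
        (quasiMeasurePreserving_sub (volume : Measure (E n)) volume)
    · exact hw.aemeasurable.aestronglyMeasurable.comp_quasiMeasurePreserving
        Measure.quasiMeasurePreserving_snd
  rw [eLpNorm_two_sq, ← measurePreserving_prod_sub.lintegral_comp_emb
    measurableEmbedding_prod_sub]
  simp only [nonlocalGrad, sub_sub_cancel]
  rw [Measure.volume_eq_prod, lintegral_prod_symm _ hm]
  refine lintegral_congr fun h => ?_
  rw [eLpNorm_two_sq, ← lintegral_const_mul' _ _ (by finiteness)]
  refine lintegral_congr fun x => ?_
  rw [enorm_mul, mul_pow, mul_comm]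

/-- The bound of `norm_mul_eLpNorm_le` for a single step `h` is squared, multiplied by `w h ^ 2` and
integrated over `h`. The left side becomes `n` times the squared norm of `v`, and `n ≥ 1`. -/
lemma eLpNorm_le_eLpNorm_nonlocalGrad (hn : n ≠ 0) (hΩ : Bornology.IsBounded Ω)
    (hw : IsKernel δ w) (hv : AEStronglyMeasurable v) (hv0 : ∀ x, x ∉ Ω → v x = 0) :
    eLpNorm v 2 volume
      ≤ ENNReal.ofReal (Metric.diam Ω + δ) * eLpNorm (nonlocalGrad w v) 2 volume := by
  rw [← ENNReal.pow_le_pow_left_iff two_ne_zero, mul_pow, eLpNorm_nonlocalGrad_sq hw hv,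
    ← lintegral_const_mul' _ _ (by finiteness)]
  have h1 : (1 : ℝ≥0∞) ≤ n := by exact_mod_cast Nat.one_le_iff_ne_zero.2 hn
  calc eLpNorm v 2 volume ^ 2 ≤ n * eLpNorm v 2 volume ^ 2 := le_mul_of_one_le_left' h1
    _ = ∫⁻ h, ENNReal.ofReal (‖h‖ ^ 2 * w h ^ 2) * eLpNorm v 2 volume ^ 2 := by
        rw [lintegral_mul_const'', hw.lintegral_norm_sq_mul_sq hn]
        exact ((hw.integrable_norm_sq_mul_sq hn).1.aemeasurable).ennreal_ofReal
    _ ≤ _ := by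
        refine lintegral_mono fun h => ?_
        by_cases hwh : w h = 0
        · simp [hwh]
        have := norm_mul_eLpNorm_le hΩ hv hv0 (hw.norm_lt_of_ne_zero hwh)
        have he : ENNReal.ofReal (‖h‖ ^ 2 * w h ^ 2)
            = ENNReal.ofReal ‖h‖ ^ 2 * ‖w h‖ₑ ^ 2 := by
          rw [ENNReal.ofReal_mul (by positivity), ENNReal.ofReal_pow (norm_nonneg _),
            ← sq_abs (w h), ENNReal.ofReal_pow (abs_nonneg _), ← Real.norm_eq_abs (w h),
            ofReal_norm (w h)]
        rw [he]
        calc ENNReal.ofReal ‖h‖ ^ 2 * ‖w h‖ₑ ^ 2 * eLpNorm v 2 volume ^ 2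
            = ‖w h‖ₑ ^ 2 * (ENNReal.ofReal ‖h‖ * eLpNorm v 2 volume) ^ 2 := by ring
          _ ≤ ‖w h‖ₑ ^ 2 * (ENNReal.ofReal (Metric.diam Ω + δ)
                * eLpNorm (fun x => v x - v (x - h)) 2 volume) ^ 2 := by gcongr
          _ = _ := by ring

/-- The nonlocal Poincaré inequality. -/
lemma l2norm_le_l2norm_nonlocalGrad (hn : n ≠ 0) (hΩo : MeasurableSet Ω)
    (hΩ : Bornology.IsBounded Ω) (hδ : 0 < δ) (hw : IsKernel δ w) (hv : v ∈ GradDomain Ω δ w) :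
    l2norm volume v ≤ (Metric.diam Ω + δ) * l2norm
      (volume.restrict (Metric.thickening δ Ω ×ˢ Metric.thickening δ Ω)) (nonlocalGrad w v) := by
  have h := eLpNorm_le_eLpNorm_nonlocalGrad hn hΩ hw (memLp_of_mem_gradDomain hΩo hv).1 hv.2.1
  have hD : 0 ≤ Metric.diam Ω := Metric.diam_nonneg
  rw [l2norm, l2norm, eLpNorm_nonlocalGrad_restrict hw hv.2.1,
    ← ENNReal.toReal_ofReal (add_nonneg hD hδ.le), ← ENNReal.toReal_mul]
  exact ENNReal.toReal_mono (ENNReal.mul_ne_top ENNReal.ofReal_ne_top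
    (memLp_nonlocalGrad hw hv).2.ne) h

lemma nonlocalGrad_add (w u v : E n → ℝ) :
    nonlocalGrad w (u + v) = nonlocalGrad w u + nonlocalGrad w v := by
  ext z; simp [nonlocalGrad]; ring

lemma nonlocalGrad_smul (c : ℝ) (w v : E n → ℝ) :
    nonlocalGrad w (c • v) = c • nonlocalGrad w v := by
  ext z; simp [nonlocalGrad]; ring

/-- The domain of the nonlocal gradient as a space of functions. -/
def gradSpace (Ω : Set (E n)) (δ : ℝ) (w : E n → ℝ) : Submodule ℝ (E n → ℝ) where
  carrier := GradDomain Ω δ w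
  zero_mem' := ⟨MemLp.zero, fun _ _ => rfl, by
    have : nonlocalGrad w (0 : E n → ℝ) = 0 := by ext z; simp [nonlocalGrad]
    rw [this]; exact MemLp.zero⟩
  add_mem' := fun {u v} hu hv => ⟨hu.1.add hv.1, fun x hx => by
    simp [hu.2.1 x hx, hv.2.1 x hx], by
    rw [nonlocalGrad_add]; exact MemLp.add hu.2.2 hv.2.2⟩
  smul_mem' := fun c v hv => ⟨hv.1.const_smul c, fun x hx => by simp [hv.2.1 x hx], by
    rw [nonlocalGrad_smul]; exact MemLp.const_smul hv.2.2 c⟩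

/-- The Poincaré inequality turns the bound by the norm of `v` into one by the norm of its nonlocal
gradient, as `exists_inner_eq_of_bound` requires. -/
lemma exists_flux_of_functional (hn : n ≠ 0) (hΩo : MeasurableSet Ω)
    (hΩ : Bornology.IsBounded Ω) (hδ : 0 < δ) (hw : IsKernel δ w)
    (L : gradSpace Ω δ w →ₗ[ℝ] ℝ) {K : ℝ} (hK : 0 ≤ K)
    (hL : ∀ v : gradSpace Ω δ w, |L v| ≤ K * l2norm volume (v : E n → ℝ)) :
    ∃ r : E n × E n → ℝ, MemL2Pair Ω δ r ∧
      l2norm (volume.restrict (Metric.thickening δ Ω ×ˢ Metric.thickening δ Ω)) r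
        ≤ K * (Metric.diam Ω + δ) ∧
      ∀ v : gradSpace Ω δ w, ∫ z in Metric.thickening δ Ω ×ˢ Metric.thickening δ Ω,
        r z * nonlocalGrad w v z = L v := by
  have hD : 0 ≤ Metric.diam Ω := Metric.diam_nonneg
  have hmem : ∀ v : gradSpace Ω δ w, MemLp (nonlocalGrad w v) 2
      (volume.restrict (Metric.thickening δ Ω ×ˢ Metric.thickening δ Ω)) := fun v => v.2.2.2
  let G : gradSpace Ω δ w →ₗ[ℝ] Lp ℝ 2
      (volume.restrict (Metric.thickening δ Ω ×ˢ Metric.thickening δ Ω)) :=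
    { toFun := fun v => (hmem v).toLp
      map_add' := fun u v => (MemLp.toLp_congr _ ((hmem u).add (hmem v))
        (Eventually.of_forall fun z => by
          rw [Submodule.coe_add, nonlocalGrad_add])).trans (MemLp.toLp_add (hmem u) (hmem v))
      map_smul' := fun c v => (MemLp.toLp_congr _ ((hmem v).const_smul c)
        (Eventually.of_forall fun z => by
          rw [Submodule.coe_smul, nonlocalGrad_smul])).trans (MemLp.toLp_const_smul c (hmem v)) }
  obtain ⟨r, hr, hrG⟩ := exists_inner_eq_of_bound G L
    (mul_nonneg hK (add_nonneg hD hδ.le)) fun v => by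
      refine (hL v).trans ?_
      rw [mul_assoc]
      refine mul_le_mul_of_nonneg_left ?_ hK
      have := l2norm_le_l2norm_nonlocalGrad hn hΩo hΩ hδ hw v.2
      rwa [← l2norm_toLp (hmem v)] at this
  refine ⟨r, Lp.memLp r, hr, fun v => ?_⟩
  rw [← hrG v]
  have h := inner_toLp_eq_integral_mul (Lp.memLp r) (hmem v)
  rw [Lp.toLp_coeFn] at h
  exact h.symm

end Domain

/-! ### The flux of a smooth field and its approximate divergence -/

lemma tr_continuousLinear_integral {v : E n → ℝ} {A : E n → E n →L[ℝ] E n}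
    (h : Integrable fun x => v x • A x) : tr (∫ x, v x • A x) = ∫ x, tr (A x) * v x := by
  have hi : ∀ i : Fin n, (∫ x, v x • A x) (EuclideanSpace.single i 1) i
      = ∫ x, v x * A x (EuclideanSpace.single i 1) i := fun i => by
    have := (((EuclideanSpace.proj i : E n →L[ℝ] ℝ).comp
      (ContinuousLinearMap.apply ℝ (E n) (EuclideanSpace.single i 1))).integral_comp_comm h)
    exact this.symm
  have hint : ∀ i : Fin n, Integrable fun x => v x * A x (EuclideanSpace.single i 1) i :=
    fun i => ((EuclideanSpace.proj i : E n →L[ℝ] ℝ).comp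
      (ContinuousLinearMap.apply ℝ (E n) (EuclideanSpace.single i 1))).integrable_comp h
  rw [tr, Finset.sum_congr rfl fun i _ => hi i, ← integral_finsetSum _ fun i _ => hint i]
  refine integral_congr_ae (ae_of_all _ fun x => ?_)
  simp only [tr, Finset.sum_mul]
  exact Finset.sum_congr rfl fun i _ => mul_comm _ _

/-- The nonlocal flux associated with a vector field. -/
def fieldFlux (w : E n → ℝ) (Q : E n → E n) (z : E n × E n) : ℝ :=
  inner ℝ (Q z.1) (z.1 - z.2) * w (z.1 - z.2)

section FieldFlux

variable {Ω : Set (E n)} {δ : ℝ} {w v : E n → ℝ} {Q : E n → E n}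

lemma IsKernel.aestronglyMeasurable_snd (hw : IsKernel δ w) :
    AEStronglyMeasurable (fun z : E n × E n => w z.2) :=
  hw.aemeasurable.aestronglyMeasurable.comp_quasiMeasurePreserving
    Measure.quasiMeasurePreserving_snd

lemma IsKernel.integrable_mul_of_le (hn : n ≠ 0) (hw : IsKernel δ w) {a : E n → ℝ}
    (ha : Integrable a) {b : E n × E n → ℝ} (hbm : AEStronglyMeasurable b)
    (hb : ∀ z, |b z| ≤ |a z.1| * (‖z.2‖ ^ 2 * w z.2 ^ 2)) : Integrable b := by
  refine (ha.abs.mul_prod (hw.integrable_norm_sq_mul_sq hn)).mono' hbm (ae_of_all _ hb)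

lemma fieldFlux_prod_sub (w : E n → ℝ) (Q : E n → E n) (z : E n × E n) :
    fieldFlux w Q (z.1, z.1 - z.2) = inner ℝ (Q z.1) z.2 * w z.2 := by
  simp [fieldFlux]

lemma memLp_fieldFlux (hn : n ≠ 0) (hw : IsKernel δ w) (hQ : Continuous Q)
    (hQc : HasCompactSupport Q) : MemLp (fieldFlux w Q) 2 := by
  have hm : AEStronglyMeasurable fun z : E n × E n => inner ℝ (Q z.1) z.2 * w z.2 := by
    refine AEStronglyMeasurable.mul (Continuous.aestronglyMeasurable (by fun_prop)) ?_
    exact hw.aestronglyMeasurable_snd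
  have h : MemLp (fun z : E n × E n => fieldFlux w Q (z.1, z.1 - z.2)) 2 := by
    simp_rw [fieldFlux_prod_sub]
    rw [memLp_two_iff_integrable_sq hm]
    have ha : Integrable fun x => ‖Q x‖ ^ 2 :=
      (hQ.norm.pow 2).integrable_of_hasCompactSupport (by
        refine hQc.mono fun x hx => ?_
        contrapose! hx
        rw [Function.notMem_support] at hx ⊢
        simp [hx])
    refine hw.integrable_mul_of_le hn ha (hm.pow 2) fun z => ?_
    rw [abs_of_nonneg (sq_nonneg _), abs_of_nonneg (sq_nonneg _)]
    have hle : inner ℝ (Q z.1) z.2 ^ 2 ≤ (‖Q z.1‖ * ‖z.2‖) ^ 2 := by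
      rw [← sq_abs]
      gcongr
      exact abs_real_inner_le_norm _ _
    calc (inner ℝ (Q z.1) z.2 * w z.2) ^ 2 = inner ℝ (Q z.1) z.2 ^ 2 * w z.2 ^ 2 := by ring
      _ ≤ (‖Q z.1‖ * ‖z.2‖) ^ 2 * w z.2 ^ 2 := by gcongr
      _ = _ := by ring
  have h2 := h.comp_measurePreserving (measurePreserving_prod_sub (n := n))
  have he : fieldFlux w Q = (fun z => fieldFlux w Q (z.1, z.1 - z.2)) ∘
      fun z => (z.1, z.1 - z.2) := by
    ext z
    simp
  rw [he]
  exact h2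

lemma memLp_two_of_continuous {F : Type*} [NormedAddCommGroup F] {φ : E n → F}
    (hφ : Continuous φ) (hc : HasCompactSupport φ) : MemLp φ 2 :=
  hφ.memLp_of_hasCompactSupport hc

/-- Discrete integration by parts: a shift of variables moves the difference from `v` to `Q`. -/
lemma integral_inner_mul_sub_translate (hv : MemLp v 2) (hQ : Continuous Q)
    (hQc : HasCompactSupport Q) (h : E n) :
    ∫ x, inner ℝ (Q x) h * (v x - v (x - h)) = ∫ x, inner ℝ (Q x - Q (x + h)) h * v x := by
  have hφ : MemLp (fun x => inner ℝ (Q x) h) 2 := by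
    refine memLp_two_of_continuous (by fun_prop) (hQc.mono fun x hx => ?_)
    contrapose! hx
    rw [Function.notMem_support] at hx ⊢
    simp [hx]
  have hm := measurePreserving_sub_right (volume : Measure (E n)) h
  have hm' := measurePreserving_add_right (volume : Measure (E n)) h
  have hφ' : MemLp (fun x => inner ℝ (Q (x + h)) h) 2 := hφ.comp_measurePreserving hm'
  have hvh : MemLp (fun x => v (x - h)) 2 := hv.comp_measurePreserving hm
  have h1 : Integrable fun x => inner ℝ (Q x) h * v x := hφ.integrable_mul hv
  have h2 : Integrable fun x => inner ℝ (Q x) h * v (x - h) := hφ.integrable_mul hvh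
  have h3 : Integrable fun x => inner ℝ (Q (x + h)) h * v x := hφ'.integrable_mul hv
  have h4 := integral_add_right_eq_self (μ := (volume : Measure (E n)))
    (fun x => inner ℝ (Q x) h * v (x - h)) h
  simp only [add_sub_cancel_right] at h4
  simp_rw [mul_sub, inner_sub_left, sub_mul]
  rw [integral_sub h1 h2, integral_sub h1 h3, h4]

/-- Only `‖h‖² w²` is known to be integrable, so the terms with `v x` and `v (x - h)` are not split;
the integrand is a product of two functions in `L²`. -/
lemma integrable_flux_mul_grad (hn : n ≠ 0) (hw : IsKernel δ w) (hv : v ∈ GradDomain Ω δ w)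
    (hQ : Continuous Q) (hQc : HasCompactSupport Q) :
    Integrable fun z : E n × E n =>
      w z.2 ^ 2 * (inner ℝ (Q z.1) z.2 * (v z.1 - v (z.1 - z.2))) := by
  have h := (memLp_fieldFlux hn hw hQ hQc).integrable_mul (memLp_nonlocalGrad hw hv)
  have h2 := measurePreserving_prod_sub.integrable_comp_of_integrable h
  refine h2.congr (ae_of_all _ fun z => ?_)
  simp [fieldFlux, nonlocalGrad]
  ring

lemma integral_fieldFlux_mul_grad (hn : n ≠ 0) (hΩ : MeasurableSet Ω) (hw : IsKernel δ w)
    (hv : v ∈ GradDomain Ω δ w) (hQ : Continuous Q) (hQc : HasCompactSupport Q) :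
    ∫ z in Metric.thickening δ Ω ×ˢ Metric.thickening δ Ω, fieldFlux w Q z * nonlocalGrad w v z
      = ∫ h, w h ^ 2 * ∫ x, inner ℝ (Q x - Q (x + h)) h * v x := by
  rw [setIntegral_eq_integral_of_forall_compl_eq_zero fun z hz => by
      rw [nonlocalGrad_eq_zero_of_notMem hw hv.2.1 hz, mul_zero],
    ← measurePreserving_prod_sub.integral_comp measurableEmbedding_prod_sub]
  have hint := integrable_flux_mul_grad hn hw hv hQ hQc
  have he : ∀ z : E n × E n, fieldFlux w Q (z.1, z.1 - z.2) * nonlocalGrad w v (z.1, z.1 - z.2)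
      = w z.2 ^ 2 * (inner ℝ (Q z.1) z.2 * (v z.1 - v (z.1 - z.2))) := fun z => by
    simp [fieldFlux, nonlocalGrad]
    ring
  simp_rw [he]
  rw [Measure.volume_eq_prod, integral_prod_symm _ hint]
  refine integral_congr_ae (ae_of_all _ fun h => ?_)
  simp only
  rw [integral_const_mul,
    integral_inner_mul_sub_translate (memLp_of_mem_gradDomain hΩ hv) hQ hQc]

/-- The mean value inequality on the ball of radius `‖h‖`, where the derivative differs from its
value at `x` by at most `M ‖h‖`. -/
lemma norm_taylor_le {M : NNReal} (hQ : Differentiable ℝ Q) (hM : LipschitzWith M (fderiv ℝ Q))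
    (x h : E n) : ‖Q (x + h) - Q x - fderiv ℝ Q x h‖ ≤ M * ‖h‖ ^ 2 := by
  have := (convex_closedBall x ‖h‖).norm_image_sub_le_of_norm_fderiv_le' (𝕜 := ℝ) (f := Q)
    (φ := fderiv ℝ Q x) (C := M * ‖h‖) (x := x) (y := x + h) (fun y _ => hQ y)
    (fun y hy => by
      rw [← dist_eq_norm]
      refine (hM.dist_le_mul y x).trans ?_
      gcongr
      exact hy) (by simp) (by simp)
  rw [add_sub_cancel_left] at this
  calc _ ≤ _ := this
    _ = _ := by ring

/-- After the discrete integration by parts, `(Q x - Q (x + h)) · h` is `-(DQ(x) h) · h` up to `M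
‖h‖³ ≤ M δ ‖h‖²`. Against `w²` the main term gives `-div Q` by isotropy, and the error gives the
factor `M δ n`. -/
lemma abs_integral_fieldFlux_mul_grad_add_le (hn : n ≠ 0) (hΩ : MeasurableSet Ω)
    (hw : IsKernel δ w) (hv : v ∈ GradDomain Ω δ w) (hvi : Integrable v)
    (hQ : ContDiff ℝ 1 Q) (hQc : HasCompactSupport Q) {M : NNReal}
    (hM : LipschitzWith M (fderiv ℝ Q)) :
    |(∫ z in Metric.thickening δ Ω ×ˢ Metric.thickening δ Ω,
        fieldFlux w Q z * nonlocalGrad w v z) + ∫ x, tr (fderiv ℝ Q x) * v x|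
      ≤ M * δ * n * ∫ x, |v x| := by
  have hv2 := memLp_of_mem_gradDomain hΩ hv
  have hDc : Continuous (fderiv ℝ Q) := hQ.continuous_fderiv (by norm_num)
  have hDs : HasCompactSupport (fderiv ℝ Q) := hQc.fderiv ℝ
  obtain ⟨B, hB⟩ := hDs.exists_bound_of_continuous hDc
  have hA : Integrable fun x => v x • fderiv ℝ Q x := by
    refine (hvi.norm.const_mul B).mono' (hvi.1.smul hDc.aestronglyMeasurable)
      (ae_of_all _ fun x => ?_)
    rw [norm_smul, mul_comm]
    gcongr
    exact hB x
  -- Averaging the derivative against `v` first leaves a single matrix, to which the moment formula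
  -- applies directly.
  set A : E n →L[ℝ] E n := ∫ x, v x • fderiv ℝ Q x with hAdef
  have hAh : ∀ h : E n, inner ℝ (A h) h = ∫ x, inner ℝ (fderiv ℝ Q x h) h * v x := fun h => by
    have := ((innerSL ℝ h).comp (ContinuousLinearMap.apply ℝ (E n) h)).integral_comp_comm hA
    rw [real_inner_comm]
    refine Eq.trans this.symm (integral_congr_ae (ae_of_all _ fun x => ?_))
    simp [real_inner_comm, mul_comm]
  rw [integral_fieldFlux_mul_grad hn hΩ hw hv hQ.continuous hQc,
    ← tr_continuousLinear_integral hA, ← hAdef, ← hw.integral_quadratic hn A]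
  have hi1 : Integrable fun h => w h ^ 2 * ∫ x, inner ℝ (Q x - Q (x + h)) h * v x := by
    refine (integrable_flux_mul_grad hn hw hv hQ.continuous hQc).integral_prod_right.congr
      (ae_of_all _ fun h => ?_)
    simp only
    rw [integral_const_mul, integral_inner_mul_sub_translate hv2 hQ.continuous hQc]
  rw [← integral_add hi1 (hw.integrable_quadratic hn A), ← Real.norm_eq_abs]
  have hbound : ∀ h : E n, ‖w h ^ 2 * (∫ x, inner ℝ (Q x - Q (x + h)) h * v x)
      + w h ^ 2 * inner ℝ (A h) h‖ ≤ (M * δ * ∫ x, |v x|) * (‖h‖ ^ 2 * w h ^ 2) := by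
    intro h
    by_cases hwh : w h = 0
    · simp [hwh]
    have hδ := hw.norm_lt_of_ne_zero hwh
    have hx1 : Integrable fun x => inner ℝ (Q x - Q (x + h)) h * v x := by
      have hφ : ∀ a : E n, MemLp (fun x => Q (x + a)) 2 := fun a =>
        (memLp_two_of_continuous hQ.continuous hQc).comp_measurePreserving
          (measurePreserving_add_right volume a)
      have h0 := (hφ 0).sub (hφ h)
      simp only [add_zero] at h0
      exact (h0.inner_const h).integrable_mul hv2
    have hx2 : Integrable fun x => inner ℝ (fderiv ℝ Q x h) h * v x := by
      have := ((innerSL ℝ h).comp (ContinuousLinearMap.apply ℝ (E n) h)).integrable_comp hA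
      refine this.congr (ae_of_all _ fun x => ?_)
      simp [real_inner_comm, mul_comm]
    rw [hAh, ← mul_add, ← integral_add hx1 hx2, norm_mul, Real.norm_eq_abs (w h ^ 2),
      abs_of_nonneg (sq_nonneg _)]
    have hle : ‖∫ x, (inner ℝ (Q x - Q (x + h)) h * v x + inner ℝ (fderiv ℝ Q x h) h * v x)‖
        ≤ ∫ x, M * ‖h‖ ^ 2 * δ * |v x| := by
      refine norm_integral_le_of_norm_le (hvi.abs.const_mul _) (ae_of_all _ fun x => ?_)
      rw [← add_mul, ← inner_add_left, norm_mul, Real.norm_eq_abs (v x)]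
      gcongr
      calc ‖inner ℝ (Q x - Q (x + h) + fderiv ℝ Q x h) h‖
          ≤ ‖Q x - Q (x + h) + fderiv ℝ Q x h‖ * ‖h‖ := norm_inner_le_norm _ _
        _ ≤ (M * ‖h‖ ^ 2) * δ := by
            gcongr
            have := norm_taylor_le (hQ.differentiable (by norm_num)) hM x h
            rw [← norm_neg] at this
            have he : Q x - Q (x + h) + fderiv ℝ Q x h
                = -(Q (x + h) - Q x - fderiv ℝ Q x h) := by abel
            rwa [he]
    rw [integral_const_mul] at hle
    calc _ ≤ w h ^ 2 * (M * ‖h‖ ^ 2 * δ * ∫ x, |v x|) := by gcongr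
      _ = _ := by ring
  refine (norm_integral_le_of_norm_le ((hw.integrable_norm_sq_mul_sq hn).const_mul _)
    (ae_of_all _ hbound)).trans (le_of_eq ?_)
  rw [integral_const_mul, hw.integral_norm_sq_mul_sq hn]
  ring

end FieldFlux

/-! ### The energy of the flux of a smooth field -/

/-- Young's inequality for the cross term. It serves to compare `q` with its smooth approximation
and to add the correcting flux. -/
lemma integral_weighted_sq_add_le {α F : Type*} [MeasurableSpace α] {μ : Measure α}
    [NormedAddCommGroup F] {m : α → ℝ} (hm : AEStronglyMeasurable m μ) {B : ℝ}
    (hB : ∀ᵐ x ∂μ, m x ∈ Icc 0 B) {a b : α → F} (ha : MemLp a 2 μ) (hb : MemLp b 2 μ)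
    {η : ℝ} (hη : 0 < η) :
    ∫ x, m x * ‖a x + b x‖ ^ 2 ∂μ
      ≤ (1 + η) * ∫ x, m x * ‖a x‖ ^ 2 ∂μ + (1 + η⁻¹) * (B * l2norm μ b ^ 2) := by
  have ha2 : Integrable (fun x => ‖a x‖ ^ 2) μ := ha.integrable_norm_pow (by norm_num)
  have hb2 : Integrable (fun x => ‖b x‖ ^ 2) μ := hb.integrable_norm_pow (by norm_num)
  have hma : Integrable (fun x => m x * ‖a x‖ ^ 2) μ :=
    (ha2.const_mul B).mono' (hm.mul ha2.1) (by
      filter_upwards [hB] with x hx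
      rw [norm_mul, Real.norm_of_nonneg hx.1, Real.norm_of_nonneg (sq_nonneg _)]
      exact mul_le_mul_of_nonneg_right hx.2 (sq_nonneg _))
  rw [l2norm_sq hb, ← integral_const_mul, ← integral_const_mul, ← integral_const_mul,
    ← integral_add (hma.const_mul _) ((hb2.const_mul _).const_mul _)]
  refine integral_mono_of_nonneg ?_ ((hma.const_mul _).add ((hb2.const_mul _).const_mul _)) ?_
  · filter_upwards [hB] with x hx
    exact mul_nonneg hx.1 (sq_nonneg _)
  · filter_upwards [hB] with x hx
    have h1 : ‖a x + b x‖ ^ 2 ≤ (1 + η) * ‖a x‖ ^ 2 + (1 + η⁻¹) * ‖b x‖ ^ 2 := by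
      have h2 : ‖a x + b x‖ ^ 2 ≤ (‖a x‖ + ‖b x‖) ^ 2 := by
        gcongr
        exact norm_add_le _ _
      have h3 : 2 * ‖a x‖ * ‖b x‖ ≤ η * ‖a x‖ ^ 2 + η⁻¹ * ‖b x‖ ^ 2 := by
        have h4 : 0 ≤ η⁻¹ * (η * ‖a x‖ - ‖b x‖) ^ 2 := by positivity
        have h5 : η⁻¹ * (η * ‖a x‖ - ‖b x‖) ^ 2
            = η * ‖a x‖ ^ 2 + η⁻¹ * ‖b x‖ ^ 2 - 2 * ‖a x‖ * ‖b x‖ := by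
          field_simp
          ring
        linarith
      nlinarith
    have h6 : m x * ‖b x‖ ^ 2 ≤ B * ‖b x‖ ^ 2 := mul_le_mul_of_nonneg_right hx.2 (sq_nonneg _)
    have h7 := mul_le_mul_of_nonneg_left h1 hx.1
    have h8 : 0 ≤ 1 + η⁻¹ := by positivity
    have h9 := mul_le_mul_of_nonneg_left h6 h8
    calc m x * ‖a x + b x‖ ^ 2 ≤ m x * ((1 + η) * ‖a x‖ ^ 2 + (1 + η⁻¹) * ‖b x‖ ^ 2) := h7
      _ = (1 + η) * (m x * ‖a x‖ ^ 2) + (1 + η⁻¹) * (m x * ‖b x‖ ^ 2) := by ring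
      _ ≤ _ := by gcongr

section Energy

variable {Ω : Set (E n)} {δ κmin κmax γ : ℝ} {w κ : E n → ℝ} {Q : E n → E n}

lemma aestronglyMeasurable_of_mem_nonlocalAdm {δ' : ℝ} (hκ : κ ∈ NonlocalAdm Ω δ' κmin κmax γ)
    (hδ : δ ≤ δ') : AEStronglyMeasurable κ (volume.restrict (Metric.thickening δ Ω)) :=
  hκ.1.1.mono_set (Metric.thickening_mono hδ Ω)

lemma ae_mem_Icc_of_mem_nonlocalAdm {δ' : ℝ} (hκ : κ ∈ NonlocalAdm Ω δ' κmin κmax γ)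
    (hδ : δ ≤ δ') : ∀ᵐ x ∂volume.restrict (Metric.thickening δ Ω), κ x ∈ Icc κmin κmax := by
  have h : ∀ᵐ x ∂volume.restrict (Ω ∪ Metric.thickening δ' Ω \ Ω), κ x ∈ Icc κmin κmax :=
    (ae_restrict_union_iff _ _ _).2 ⟨hκ.2.1.2.1, hκ.2.2⟩
  refine ae_restrict_of_ae_restrict_of_subset ?_ h
  rw [union_sdiff_self]
  exact (Metric.thickening_mono hδ Ω).trans subset_union_right

/-- This splits the energy density into two parts, each with the conductivity at one point only. -/
lemma inv_harmonicAvg {z : E n × E n} (h1 : 0 < κ z.1) (h2 : 0 < κ z.2) :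
    (harmonicAvg κ z)⁻¹ = (1 / 2) * ((κ z.1)⁻¹ + (κ z.2)⁻¹) := by
  unfold harmonicAvg
  field_simp
  ring

lemma ae_restrict_prod_of_ae {s : Set (E n)} {P : E n → Prop}
    (h : ∀ᵐ x ∂volume.restrict s, P x) :
    ∀ᵐ z : E n × E n ∂volume.restrict (s ×ˢ s), P z.1 ∧ P z.2 := by
  rw [Measure.volume_eq_prod, ← Measure.prod_restrict]
  exact (Measure.quasiMeasurePreserving_fst.ae h).and (Measure.quasiMeasurePreserving_snd.ae h)

lemma aestronglyMeasurable_inv_harmonicAvg {s : Set (E n)}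
    (hκ : AEStronglyMeasurable κ (volume.restrict s)) :
    AEStronglyMeasurable (fun z : E n × E n => (harmonicAvg κ z)⁻¹)
      (volume.restrict (s ×ˢ s)) := by
  rw [Measure.volume_eq_prod, ← Measure.prod_restrict]
  have h1 : AEMeasurable (fun z : E n × E n => κ z.1)
      ((volume.restrict s).prod (volume.restrict s)) :=
    hκ.aemeasurable.comp_quasiMeasurePreserving Measure.quasiMeasurePreserving_fst
  have h2 : AEMeasurable (fun z : E n × E n => κ z.2)
      ((volume.restrict s).prod (volume.restrict s)) :=
    hκ.aemeasurable.comp_quasiMeasurePreserving Measure.quasiMeasurePreserving_snd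
  exact ((((h1.const_mul 2).mul h2).div (h1.add h2)).inv).aestronglyMeasurable

lemma ae_inv_harmonicAvg_mem_Icc {s : Set (E n)} (hκmin : 0 < κmin)
    (hκ : ∀ᵐ x ∂volume.restrict s, κ x ∈ Icc κmin κmax) :
    ∀ᵐ z : E n × E n ∂volume.restrict (s ×ˢ s), (harmonicAvg κ z)⁻¹ ∈ Icc 0 κmin⁻¹ := by
  filter_upwards [ae_restrict_prod_of_ae hκ] with z hz
  have h1 : 0 < κ z.1 := hκmin.trans_le hz.1.1
  have h2 : 0 < κ z.2 := hκmin.trans_le hz.2.1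
  rw [inv_harmonicAvg h1 h2]
  refine ⟨by positivity, ?_⟩
  have h3 : (κ z.1)⁻¹ ≤ κmin⁻¹ := inv_anti₀ hκmin hz.1.1
  have h4 : (κ z.2)⁻¹ ≤ κmin⁻¹ := inv_anti₀ hκmin hz.2.1
  linarith

lemma nonlocalEnergy_nonneg (hκmin : 0 < κmin)
    (hκ : ∀ᵐ x ∂volume.restrict (Metric.thickening δ Ω), κ x ∈ Icc κmin κmax)
    (p : E n × E n → ℝ) : 0 ≤ nonlocalEnergy Ω δ (harmonicAvg κ) p := by
  refine mul_nonneg (by norm_num) (integral_nonneg_of_ae ?_)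
  filter_upwards [ae_inv_harmonicAvg_mem_Icc hκmin hκ] with z hz
  exact mul_nonneg hz.1 (sq_nonneg _)

/-- A difference of squares, with `M₁` bounding the difference factor and `2 M₀` the sum. It moves
the field to the point where the conductivity is evaluated. -/
lemma inner_sq_le_inner_sq_add {M₀ M₁ : ℝ} (hM₀ : ∀ x, ‖Q x‖ ≤ M₀)
    (hM₁ : ∀ x y, ‖Q x - Q y‖ ≤ M₁ * ‖x - y‖) (x y : E n) :
    inner ℝ (Q x) (x - y) ^ 2
      ≤ inner ℝ (Q y) (x - y) ^ 2 + 2 * (M₀ * M₁) * ‖x - y‖ * ‖x - y‖ ^ 2 := by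
  have hM : 0 ≤ M₀ := (norm_nonneg _).trans (hM₀ x)
  have h1 : |inner ℝ (Q x - Q y) (x - y)| ≤ M₁ * ‖x - y‖ * ‖x - y‖ :=
    (abs_real_inner_le_norm _ _).trans (by gcongr; exact hM₁ x y)
  have h2 : |inner ℝ (Q x + Q y) (x - y)| ≤ 2 * M₀ * ‖x - y‖ := by
    refine (abs_real_inner_le_norm _ _).trans ?_
    gcongr
    exact (norm_add_le _ _).trans (by linarith [hM₀ x, hM₀ y])
  have h3 : inner ℝ (Q x) (x - y) ^ 2 - inner ℝ (Q y) (x - y) ^ 2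
      = inner ℝ (Q x - Q y) (x - y) * inner ℝ (Q x + Q y) (x - y) := by
    rw [inner_sub_left, inner_add_left]
    ring
  have h4 : inner ℝ (Q x - Q y) (x - y) * inner ℝ (Q x + Q y) (x - y)
      ≤ (M₁ * ‖x - y‖ * ‖x - y‖) * (2 * M₀ * ‖x - y‖) := by
    refine (le_abs_self _).trans ?_
    rw [abs_mul]
    exact mul_le_mul h1 h2 (abs_nonneg _) ((abs_nonneg _).trans h1)
  linarith

lemma integrable_inv_of_mem_Icc {s : Set (E n)} (hs : volume s ≠ ⊤) (hκmin : 0 < κmin)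
    (hκm : AEStronglyMeasurable κ (volume.restrict s))
    (hκ : ∀ᵐ x ∂volume.restrict s, κ x ∈ Icc κmin κmax) :
    IntegrableOn (fun x => (κ x)⁻¹) s := by
  have : IsFiniteMeasure (volume.restrict s) := ⟨by simpa using hs.lt_top⟩
  refine Integrable.of_bound hκm.aemeasurable.inv.aestronglyMeasurable κmin⁻¹ ?_
  filter_upwards [hκ] with x hx
  have : 0 < κ x := hκmin.trans_le hx.1
  rw [Real.norm_of_nonneg (by positivity)]
  exact inv_anti₀ hκmin hx.1

/-- The energy density at the first of two points, of the flux of a vector field. -/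
def fluxDensity (w β : E n → ℝ) (Q : E n → E n) (z : E n × E n) : ℝ :=
  β z.1 * (w (z.1 - z.2) ^ 2 * inner ℝ (Q z.1) (z.1 - z.2) ^ 2)

/-- The weight at the first of two points, times the second moment density of the kernel. -/
def massDensity (w β : E n → ℝ) (z : E n × E n) : ℝ :=
  β z.1 * (‖z.1 - z.2‖ ^ 2 * w (z.1 - z.2) ^ 2)

/-- For fixed `x`, integrating over `x - x'` gives `‖Q x‖ ^ 2` by isotropy, whatever the weight `β`.
-/
lemma integral_fluxDensity (hn : n ≠ 0) (hw : IsKernel δ w) {β : E n → ℝ} (hβ : Integrable β)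
    (hQ : Continuous Q) (hQc : HasCompactSupport Q) :
    Integrable (fluxDensity w β Q) ∧ ∫ z, fluxDensity w β Q z = ∫ x, β x * ‖Q x‖ ^ 2 := by
  obtain ⟨B, hB⟩ := hQc.exists_bound_of_continuous hQ
  have ha : Integrable fun x => β x * ‖Q x‖ ^ 2 := by
    refine hβ.mul_bdd (c := B ^ 2) (hQ.norm.pow 2).aestronglyMeasurable (ae_of_all _ fun x => ?_)
    rw [Real.norm_of_nonneg (sq_nonneg _)]
    gcongr
    exact hB x
  have h : Integrable fun z : E n × E n => fluxDensity w β Q (z.1, z.1 - z.2) := by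
    refine hw.integrable_mul_of_le hn ha ?_ fun z => ?_
    · simp only [fluxDensity, sub_sub_cancel]
      refine AEStronglyMeasurable.mul ?_ (AEStronglyMeasurable.mul ?_ ?_)
      · exact hβ.1.comp_quasiMeasurePreserving Measure.quasiMeasurePreserving_fst
      · exact hw.aestronglyMeasurable_snd.pow 2
      · exact Continuous.aestronglyMeasurable (by fun_prop)
    · simp only [fluxDensity, sub_sub_cancel]
      rw [abs_mul, abs_of_nonneg (by positivity : 0 ≤ w z.2 ^ 2 * inner ℝ (Q z.1) z.2 ^ 2),
        abs_mul, abs_of_nonneg (sq_nonneg (‖Q z.1‖)), mul_assoc]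
      refine mul_le_mul_of_nonneg_left ?_ (abs_nonneg _)
      have hle : inner ℝ (Q z.1) z.2 ^ 2 ≤ (‖Q z.1‖ * ‖z.2‖) ^ 2 := by
        rw [← sq_abs]
        gcongr
        exact abs_real_inner_le_norm _ _
      calc w z.2 ^ 2 * inner ℝ (Q z.1) z.2 ^ 2 ≤ w z.2 ^ 2 * (‖Q z.1‖ * ‖z.2‖) ^ 2 := by gcongr
        _ = _ := by ring
  refine ⟨(measurePreserving_prod_sub.integrable_comp_emb measurableEmbedding_prod_sub).1 h, ?_⟩
  rw [← measurePreserving_prod_sub.integral_comp measurableEmbedding_prod_sub,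
    Measure.volume_eq_prod, integral_prod _ h]
  refine integral_congr_ae (ae_of_all _ fun x => ?_)
  simp only [fluxDensity, sub_sub_cancel]
  rw [integral_const_mul, hw.integral_inner_sq hn]

lemma integral_massDensity (hn : n ≠ 0) (hw : IsKernel δ w) {β : E n → ℝ} (hβ : Integrable β) :
    Integrable (massDensity w β) ∧ ∫ z, massDensity w β z = n * ∫ x, β x := by
  have h : Integrable fun z : E n × E n => massDensity w β (z.1, z.1 - z.2) := by
    simp only [massDensity, sub_sub_cancel]
    exact hβ.mul_prod (hw.integrable_norm_sq_mul_sq hn)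
  refine ⟨(measurePreserving_prod_sub.integrable_comp_emb measurableEmbedding_prod_sub).1 h, ?_⟩
  rw [← measurePreserving_prod_sub.integral_comp measurableEmbedding_prod_sub,
    Measure.volume_eq_prod]
  simp only [massDensity, sub_sub_cancel]
  rw [integral_prod_mul β fun h => ‖h‖ ^ 2 * w h ^ 2, hw.integral_norm_sq_mul_sq hn, mul_comm]

/-- In the half weighted by `κ(x)⁻¹` the field sits at the same point. In the half weighted by
`κ(x')⁻¹` the field is moved from `x` to `x'`, at the cost `M₀ M₁ δ` times the mass density, and the
points are swapped. -/
lemma nonlocalEnergy_fieldFlux_le (hn : n ≠ 0) (hΩ : Bornology.IsBounded Ω) (hw : IsKernel δ w)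
    (hκmin : 0 < κmin)
    (hκm : AEStronglyMeasurable κ (volume.restrict (Metric.thickening δ Ω)))
    (hκ : ∀ᵐ x ∂volume.restrict (Metric.thickening δ Ω), κ x ∈ Icc κmin κmax)
    (hQ : Continuous Q) (hQc : HasCompactSupport Q) {M₀ M₁ : ℝ} (hM₀ : ∀ x, ‖Q x‖ ≤ M₀)
    (hM₁0 : 0 ≤ M₁) (hM₁ : ∀ x y, ‖Q x - Q y‖ ≤ M₁ * ‖x - y‖) :
    nonlocalEnergy Ω δ (harmonicAvg κ) (fieldFlux w Q)
      ≤ (1 / 2) * ((∫ x in Metric.thickening δ Ω, (κ x)⁻¹ * ‖Q x‖ ^ 2)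
        + M₀ * M₁ * δ * (n * ∫ x in Metric.thickening δ Ω, (κ x)⁻¹)) := by
  set S := Metric.thickening δ Ω with hS
  have hSm : MeasurableSet S := Metric.isOpen_thickening.measurableSet
  have hSf : volume S ≠ ⊤ := (hΩ.thickening).measure_lt_top.ne
  have hM₀0 : 0 ≤ M₀ := (norm_nonneg _).trans (hM₀ 0)
  set β : E n → ℝ := S.indicator fun x => (κ x)⁻¹ with hβdef
  have hβ : Integrable β :=
    (integrable_inv_of_mem_Icc hSf hκmin hκm hκ).integrable_indicator hSm
  have hβ1 : ∫ x in S, (κ x)⁻¹ * ‖Q x‖ ^ 2 = ∫ x, β x * ‖Q x‖ ^ 2 := by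
    rw [← integral_indicator hSm]
    refine integral_congr_ae (ae_of_all _ fun x => ?_)
    simp only [hβdef, indicator]
    split_ifs <;> simp
  have hβ2 : ∫ x in S, (κ x)⁻¹ = ∫ x, β x := (integral_indicator hSm).symm
  obtain ⟨hHi, hH⟩ := integral_fluxDensity hn hw hβ hQ hQc
  obtain ⟨hRi, hR⟩ := integral_massDensity hn hw hβ
  have hsw : MeasurePreserving (Prod.swap : E n × E n → E n × E n) :=
    Measure.measurePreserving_swap
  have hswe : MeasurableEmbedding (Prod.swap : E n × E n → E n × E n) :=
    MeasurableEquiv.prodComm.measurableEmbedding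
  have hHs := (hsw.integrable_comp_emb hswe).2 hHi
  have hRs := (hsw.integrable_comp_emb hswe).2 hRi
  have hHs' := hsw.integral_comp hswe (fluxDensity w β Q)
  have hRs' := hsw.integral_comp hswe (massDensity w β)
  rw [hβ1, hβ2, ← hR, ← hH, nonlocalEnergy, ← hS]
  refine mul_le_mul_of_nonneg_left ?_ (by norm_num)
  have hsum : (∫ z, fluxDensity w β Q z) + M₀ * M₁ * δ * ∫ z, massDensity w β z
      = ∫ z, ((1 / 2) * fluxDensity w β Q z + (1 / 2) * fluxDensity w β Q z.swap
        + M₀ * M₁ * δ * massDensity w β z.swap) := by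
    have i1 : Integrable fun z : E n × E n => (1 / 2) * fluxDensity w β Q z := hHi.const_mul _
    have i2 : Integrable fun z : E n × E n => (1 / 2) * fluxDensity w β Q z.swap := hHs.const_mul _
    have i3 : Integrable fun z : E n × E n => M₀ * M₁ * δ * massDensity w β z.swap := hRs.const_mul _
    have i12 : Integrable fun z : E n × E n =>
        (1 / 2) * fluxDensity w β Q z + (1 / 2) * fluxDensity w β Q z.swap := i1.add i2
    rw [integral_add i12 i3, integral_add i1 i2, integral_const_mul, integral_const_mul,
      integral_const_mul, hHs', hRs']
    ring
  rw [hsum, ← integral_indicator (hSm.prod hSm)]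
  have hae : ∀ᵐ x : E n, x ∈ S → κ x ∈ Icc κmin κmax := (ae_restrict_iff' hSm).1 hκ
  have hae2 : ∀ᵐ z : E n × E n, (z.1 ∈ S → κ z.1 ∈ Icc κmin κmax) ∧
      (z.2 ∈ S → κ z.2 ∈ Icc κmin κmax) :=
    (Measure.quasiMeasurePreserving_fst.ae hae).and (Measure.quasiMeasurePreserving_snd.ae hae)
  have hβ0 : ∀ x, (x ∈ S → κ x ∈ Icc κmin κmax) → 0 ≤ β x := fun x hx => by
    simp only [hβdef, indicator]
    split_ifs with h
    · exact inv_nonneg.2 (hκmin.le.trans (hx h).1)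
    · exact le_rfl
  refine integral_mono_of_nonneg ?_
    (((hHi.const_mul _).add (hHs.const_mul _)).add (hRs.const_mul _)) ?_
  · filter_upwards [hae2] with z hz
    refine Set.indicator_apply_nonneg (fun hzS => ?_)
    have h1 : 0 < κ z.1 := hκmin.trans_le (hz.1 hzS.1).1
    have h2 : 0 < κ z.2 := hκmin.trans_le (hz.2 hzS.2).1
    rw [inv_harmonicAvg h1 h2]
    positivity
  · filter_upwards [hae2] with z hz
    have hδ0 : w (z.1 - z.2) = 0 ∨ ‖z.1 - z.2‖ ≤ δ := by
      by_cases h : w (z.1 - z.2) = 0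
      · exact Or.inl h
      · exact Or.inr (hw.norm_lt_of_ne_zero h).le
    have hz1 := hβ0 _ hz.1
    have hz2 := hβ0 _ hz.2
    have hws : w (z.2 - z.1) = w (z.1 - z.2) := hw.radial _ _ (norm_sub_rev _ _)
    have hsq := inner_sq_le_inner_sq_add hM₀ hM₁ z.1 z.2
    have hin : inner ℝ (Q z.2) (z.2 - z.1) ^ 2 = inner ℝ (Q z.2) (z.1 - z.2) ^ 2 := by
      rw [← neg_sub z.1 z.2, inner_neg_right, neg_sq]
    simp only [fluxDensity, massDensity, Prod.fst_swap, Prod.snd_swap, hws, hin,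
      norm_sub_rev z.2 z.1]
    -- The points are known to be within `δ` only where the kernel does not vanish; elsewhere both
    -- sides are zero.
    rcases hδ0 with h0 | hδ0
    · simp only [h0, indicator, fieldFlux]
      split_ifs <;> simp
    have hδ1 : 0 ≤ δ := (norm_nonneg _).trans hδ0
    by_cases hzS : z ∈ S ×ˢ S
    · rw [indicator_of_mem hzS]
      have h1 : 0 < κ z.1 := hκmin.trans_le (hz.1 hzS.1).1
      have h2 : 0 < κ z.2 := hκmin.trans_le (hz.2 hzS.2).1
      have hb1 : β z.1 = (κ z.1)⁻¹ := indicator_of_mem hzS.1 _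
      have hb2 : β z.2 = (κ z.2)⁻¹ := indicator_of_mem hzS.2 _
      rw [inv_harmonicAvg h1 h2, ← hb1, ← hb2, fieldFlux, mul_pow]
      set W := w (z.1 - z.2) ^ 2
      set a := inner ℝ (Q z.1) (z.1 - z.2) ^ 2
      set b := inner ℝ (Q z.2) (z.1 - z.2) ^ 2
      have hW : 0 ≤ W := sq_nonneg _
      have hab : a ≤ b + 2 * (M₀ * M₁) * δ * ‖z.1 - z.2‖ ^ 2 :=
        hsq.trans (by gcongr)
      have := mul_le_mul_of_nonneg_left hab (mul_nonneg hz2 hW)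
      nlinarith
    · rw [indicator_of_notMem hzS]
      have hM : 0 ≤ M₀ * M₁ * δ := by positivity
      positivity

lemma nonlocalEnergy_fieldFlux_le_localEnergy (hn : n ≠ 0) (hΩm : MeasurableSet Ω)
    (hΩ : Bornology.IsBounded Ω) (hδ : 0 < δ) (hw : IsKernel δ w) (hκmin : 0 < κmin)
    (hκm : AEStronglyMeasurable κ (volume.restrict (Metric.thickening δ Ω)))
    (hκ : ∀ᵐ x ∂volume.restrict (Metric.thickening δ Ω), κ x ∈ Icc κmin κmax)
    (hQ : Continuous Q) (hQc : HasCompactSupport Q) {M₀ M₁ : ℝ} (hM₀ : ∀ x, ‖Q x‖ ≤ M₀)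
    (hM₁0 : 0 ≤ M₁) (hM₁ : ∀ x y, ‖Q x - Q y‖ ≤ M₁ * ‖x - y‖) :
    nonlocalEnergy Ω δ (harmonicAvg κ) (fieldFlux w Q)
      ≤ localEnergy Ω κ Q + (1 / 2) * (M₀ ^ 2 * κmin⁻¹ * volume.real (Metric.thickening δ Ω \ Ω)
        + M₀ * M₁ * δ * (n * (κmin⁻¹ * volume.real (Metric.thickening δ Ω)))) := by
  refine (nonlocalEnergy_fieldFlux_le hn hΩ hw hκmin hκm hκ hQ hQc hM₀ hM₁0 hM₁).trans ?_
  have hSm : MeasurableSet (Metric.thickening δ Ω) := Metric.isOpen_thickening.measurableSet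
  have hSf : volume (Metric.thickening δ Ω) ≠ ⊤ := (hΩ.thickening).measure_lt_top.ne
  have hM₀0 : 0 ≤ M₀ := (norm_nonneg _).trans (hM₀ 0)
  have hβ := integrable_inv_of_mem_Icc hSf hκmin hκm hκ
  have hβQ : IntegrableOn (fun x => (κ x)⁻¹ * ‖Q x‖ ^ 2) (Metric.thickening δ Ω) := by
    refine hβ.mul_bdd (c := M₀ ^ 2) (hQ.norm.pow 2).aestronglyMeasurable (ae_of_all _ fun x => ?_)
    rw [Real.norm_of_nonneg (sq_nonneg _)]
    gcongr
    exact hM₀ x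
  have hsub : Ω ⊆ Metric.thickening δ Ω := Metric.self_subset_thickening hδ Ω
  have h1 : ∫ x in Metric.thickening δ Ω, (κ x)⁻¹ ≤ κmin⁻¹ * volume.real (Metric.thickening δ Ω) := by
    have h := setIntegral_mono_on_ae hβ (integrableOn_const hSf) hSm
      (((ae_restrict_iff' hSm).1 hκ).mono fun x hx hxS => inv_anti₀ hκmin (hx hxS).1)
    rwa [setIntegral_const, smul_eq_mul, mul_comm] at h
  have h2 : ∫ x in Metric.thickening δ Ω \ Ω, (κ x)⁻¹ * ‖Q x‖ ^ 2
      ≤ M₀ ^ 2 * κmin⁻¹ * volume.real (Metric.thickening δ Ω \ Ω) := by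
    have hf : volume (Metric.thickening δ Ω \ Ω) ≠ ⊤ := measure_ne_top_of_subset sdiff_subset hSf
    have h := setIntegral_mono_on_ae (hβQ.mono_set sdiff_subset)
      (integrableOn_const (C := M₀ ^ 2 * κmin⁻¹) hf) (hSm.diff hΩm)
      (((ae_restrict_iff' hSm).1 hκ).mono fun x hx hxS => by
        have hx' := hx hxS.1
        have : 0 < κ x := hκmin.trans_le hx'.1
        rw [mul_comm]
        gcongr
        · exact hM₀ x
        · exact hx'.1)
    rwa [setIntegral_const, smul_eq_mul, mul_comm] at h
  have h3 : ∫ x in Metric.thickening δ Ω, (κ x)⁻¹ * ‖Q x‖ ^ 2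
      = (∫ x in Ω, (κ x)⁻¹ * ‖Q x‖ ^ 2)
        + ∫ x in Metric.thickening δ Ω \ Ω, (κ x)⁻¹ * ‖Q x‖ ^ 2 := by
    have := setIntegral_union disjoint_sdiff_right (hSm.diff hΩm) (hβQ.mono_set hsub)
      (hβQ.mono_set sdiff_subset)
    rwa [union_sdiff_cancel hsub] at this
  have h4 : M₀ * M₁ * δ * (n * ∫ x in Metric.thickening δ Ω, (κ x)⁻¹)
      ≤ M₀ * M₁ * δ * (n * (κmin⁻¹ * volume.real (Metric.thickening δ Ω))) := by gcongr
  rw [localEnergy, h3, ← mul_add, add_assoc]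
  exact mul_le_mul_of_nonneg_left (by gcongr) (by norm_num)

end Energy

/-! ### Mollification in `L²` -/

open scoped Convolution

section Mollification

variable {F : Type*} [NormedAddCommGroup F]

/-- Translations act continuously on `L²`. -/
lemma exists_eLpNorm_translate_sub_le {g : E n → F} (hg : MemLp g 2) {ε : ℝ≥0∞} (hε : ε ≠ 0) :
    ∃ ρ > 0, ∀ h : E n, ‖h‖ < ρ → eLpNorm (fun x => g (x - h) - g x) 2 volume ≤ ε := by
  have : Fact ((2 : ℝ≥0∞) ≠ ⊤) := ⟨by norm_num⟩
  have hc : Continuous fun h : E n => (DomAddAct.mk (-h) +ᵥ hg.toLp g : Lp F 2 volume) :=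
    (DomAddAct.continuous_mk.comp continuous_neg).vadd continuous_const
  obtain ⟨ρ, hρ, H⟩ := Metric.eventually_nhds_iff.1
    ((hc.tendsto 0).eventually (Metric.eball_mem_nhds _ (pos_iff_ne_zero.2 hε)))
  refine ⟨ρ, hρ, fun h hh => ?_⟩
  have h1 := H (y := h) (by simpa using hh)
  have hg' : ∀ a : E n, MemLp (fun x => g (a + x)) 2 := fun a =>
    hg.comp_measurePreserving (measurePreserving_add_left volume a)
  have h2 : ∀ a : E n, (DomAddAct.mk a +ᵥ hg.toLp g : Lp F 2 volume) = (hg' a).toLp := fun a => rfl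
  rw [h2, h2, Lp.edist_toLp_toLp] at h1
  refine le_trans (le_of_eq ?_) h1.le
  congr 1
  ext x
  simp [sub_eq_neg_add]

/-- Jensen's inequality for a probability density, from Cauchy–Schwarz with `a b = a^(1/2) (a
b²)^(1/2)`. -/
lemma sq_lintegral_mul_le {α : Type*} [MeasurableSpace α] {μ : Measure α} {a b : α → ℝ≥0∞}
    (ha : AEMeasurable a μ) (hb : AEMeasurable b μ) (h1 : ∫⁻ x, a x ∂μ = 1) :
    (∫⁻ x, a x * b x ∂μ) ^ 2 ≤ ∫⁻ x, a x * b x ^ 2 ∂μ := by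
  have h := ENNReal.lintegral_mul_norm_pow_le ha (ha.mul (hb.pow_const 2))
    (p := 1 / 2) (q := 1 / 2) (by norm_num) (by norm_num) (by norm_num)
  have he : ∀ x, a x ^ (1 / 2 : ℝ) * (a * fun x => b x ^ 2) x ^ (1 / 2 : ℝ) = a x * b x := by
    intro x
    rw [Pi.mul_apply, ENNReal.mul_rpow_of_nonneg _ _ (by norm_num), ← mul_assoc,
      ← ENNReal.rpow_add_of_nonneg _ _ (by norm_num) (by norm_num), ← ENNReal.rpow_natCast,
      ← ENNReal.rpow_mul]
    norm_num
  simp_rw [he] at h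
  rw [h1, ENNReal.one_rpow, one_mul] at h
  calc (∫⁻ x, a x * b x ∂μ) ^ 2
      ≤ ((∫⁻ x, (a * fun x => b x ^ 2) x ∂μ) ^ (1 / 2 : ℝ)) ^ 2 := by gcongr
    _ = _ := by
      rw [← ENNReal.rpow_natCast, ← ENNReal.rpow_mul]
      norm_num

/-- The error is the `ψ`-average of the differences `g (x - t) - g x`, so Jensen and Tonelli apply.
The kernel need not be centred at the origin, which allows shifted mollifiers. -/
lemma eLpNorm_convolution_sub_le [NormedSpace ℝ F] [CompleteSpace F] {g : E n → F}
    (hg : MemLp g 2) {ψ : E n → ℝ} (hψ : Continuous ψ) (hψc : HasCompactSupport ψ)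
    (hψ0 : ∀ x, 0 ≤ ψ x) (hψ1 : ∫ x, ψ x = 1) {ρ : ℝ} (hψρ : Function.support ψ ⊆ Metric.ball 0 ρ)
    {ε : ℝ≥0∞} (hε : ∀ h : E n, ‖h‖ < ρ → eLpNorm (fun x => g (x - h) - g x) 2 volume ≤ ε) :
    eLpNorm ((ψ ⋆[ContinuousLinearMap.lsmul ℝ ℝ] g) - g) 2 volume ≤ ε := by
  have hψi : Integrable ψ := hψ.integrable_of_hasCompactSupport hψc
  have hψl : ∫⁻ t, ‖ψ t‖ₑ = 1 := by
    have h := ofReal_integral_eq_lintegral_ofReal hψi (ae_of_all _ hψ0)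
    rw [hψ1, ENNReal.ofReal_one] at h
    rw [h]
    exact lintegral_congr fun t => Real.enorm_of_nonneg (hψ0 t)
  have hgl : LocallyIntegrable g := hg.locallyIntegrable (by norm_num)
  have hex := hψc.convolutionExists_left (ContinuousLinearMap.lsmul ℝ ℝ) hψ hgl
    (μ := (volume : Measure (E n)))
  have hpt : ∀ x, ‖((ψ ⋆[ContinuousLinearMap.lsmul ℝ ℝ] g) - g) x‖ₑ
      ≤ ∫⁻ t, ‖ψ t‖ₑ * ‖g (x - t) - g x‖ₑ := by
    intro x
    have h1 : ((ψ ⋆[ContinuousLinearMap.lsmul ℝ ℝ] g) - g) x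
        = ∫ t, ψ t • (g (x - t) - g x) := by
      simp_rw [smul_sub]
      have hx : Integrable fun t => ψ t • g (x - t) := hex x
      rw [integral_sub hx (hψi.smul_const (g x)), integral_smul_const, hψ1, one_smul]
      rfl
    rw [h1]
    refine (enorm_integral_le_lintegral_enorm _).trans (le_of_eq ?_)
    exact lintegral_congr fun t => enorm_smul _ _
  have hm2 : AEStronglyMeasurable (fun z : E n × E n => g (z.1 - z.2) - g z.1) := by
    refine AEStronglyMeasurable.sub ?_ ?_
    · exact hg.1.comp_quasiMeasurePreserving
        (quasiMeasurePreserving_sub (volume : Measure (E n)) volume)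
    · exact hg.1.comp_quasiMeasurePreserving Measure.quasiMeasurePreserving_fst
  have hm1 : ∀ x, AEStronglyMeasurable (fun t => g (x - t) - g x) := fun x =>
    (hg.1.comp_measurePreserving (Measure.measurePreserving_sub_left volume x)).sub
      aestronglyMeasurable_const
  rw [← ENNReal.pow_le_pow_left_iff two_ne_zero, eLpNorm_two_sq]
  calc ∫⁻ x, ‖((ψ ⋆[ContinuousLinearMap.lsmul ℝ ℝ] g) - g) x‖ₑ ^ 2
      ≤ ∫⁻ x, ∫⁻ t, ‖ψ t‖ₑ * ‖g (x - t) - g x‖ₑ ^ 2 := by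
        refine lintegral_mono fun x => ?_
        exact (pow_le_pow_left₀ zero_le (hpt x) 2).trans
          (sq_lintegral_mul_le hψi.1.enorm (hm1 x).enorm hψl)
    _ = ∫⁻ t, ∫⁻ x, ‖ψ t‖ₑ * ‖g (x - t) - g x‖ₑ ^ 2 := by
        refine lintegral_lintegral_swap (AEMeasurable.mul ?_ (hm2.enorm.pow_const 2))
        exact (hψ.comp continuous_snd).measurable.enorm.aemeasurable
    _ ≤ ∫⁻ t, ‖ψ t‖ₑ * ε ^ 2 := by
        refine lintegral_mono fun t => ?_
        by_cases ht : ψ t = 0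
        · simp [ht]
        rw [lintegral_const_mul' _ _ (by finiteness), ← eLpNorm_two_sq]
        gcongr
        exact hε t (by simpa using hψρ ht)
    _ = ε ^ 2 := by
        rw [lintegral_mul_const'' _ hψi.1.enorm, hψl, one_mul]

end Mollification

/-! ### Density of smooth fields in `H(div)` -/

/-- The trace as a continuous linear functional. -/
def trL : (E n →L[ℝ] E n) →L[ℝ] ℝ :=
  ∑ i : Fin n, (EuclideanSpace.proj i : E n →L[ℝ] ℝ).comp
    (ContinuousLinearMap.apply ℝ (E n) (EuclideanSpace.single i 1))

lemma trL_apply (A : E n →L[ℝ] E n) : trL A = tr A := by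
  simp [trL, tr]

lemma tr_smulRight (A : E n →L[ℝ] ℝ) (b : E n) : tr (A.smulRight b) = A b := by
  conv_rhs => rw [← (EuclideanSpace.basisFun (Fin n) ℝ).sum_repr b, map_sum]
  refine Finset.sum_congr rfl fun i _ => ?_
  simp [mul_comm]

lemma tr_fderiv_convolution {ψ : E n → ℝ} (hψ : ContDiff ℝ 1 ψ) (hψc : HasCompactSupport ψ)
    {g : E n → E n} (hg : LocallyIntegrable g) (x : E n) :
    tr (fderiv ℝ (ψ ⋆[ContinuousLinearMap.lsmul ℝ ℝ] g) x)
      = ∫ y, fderiv ℝ ψ (x - y) (g y) := by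
  have hd := hψc.hasFDerivAt_convolution_left (ContinuousLinearMap.lsmul ℝ ℝ) hψ hg x
    (μ := (volume : Measure (E n)))
  have hex := (hψc.fderiv ℝ).convolutionExists_left
    ((ContinuousLinearMap.lsmul ℝ ℝ : ℝ →L[ℝ] E n →L[ℝ] E n).precompL (E n))
    (hψ.continuous_fderiv (by norm_num)) hg (μ := (volume : Measure (E n))) x
  rw [hd.fderiv, ← trL_apply, convolution_eq_swap, ← trL.integral_comp_comm hex.integrable_swap]
  refine integral_congr_ae (ae_of_all _ fun y => ?_)
  simp only [trL_apply]
  rw [← tr_smulRight]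
  congr 1

section Density

variable {Ω : Set (E n)} {q : E n → E n} {f : E n → ℝ}

lemma fderiv_mul_comp_const_sub {χ ψ : E n → ℝ} (hχ : Differentiable ℝ χ)
    (hψ : Differentiable ℝ ψ) (x y v : E n) :
    fderiv ℝ (fun y => χ y * ψ (x - y)) y v
      = ψ (x - y) * fderiv ℝ χ y v - χ y * fderiv ℝ ψ (x - y) v := by
  have h1 : HasFDerivAt (fun y : E n => x - y) (-ContinuousLinearMap.id ℝ (E n)) y := by
    simpa using (hasFDerivAt_id y).const_sub x
  have h2 : HasFDerivAt (fun y => ψ (x - y))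
      ((fderiv ℝ ψ (x - y)).comp (-ContinuousLinearMap.id ℝ (E n))) y :=
    (hψ (x - y)).hasFDerivAt.comp y h1
  have h3 : HasFDerivAt (fun y => χ y * ψ (x - y)) _ y := (hχ y).hasFDerivAt.mul h2
  rw [h3.fderiv]
  simp
  ring

lemma inner_gradient_right (φ : E n → ℝ) (x v : E n) :
    inner ℝ v (gradient φ x) = fderiv ℝ φ x v := by
  rw [real_inner_comm, gradient, InnerProductSpace.toDual_symm_apply]

lemma memLp_smul_indicator (hΩ : MeasurableSet Ω) {F : Type*} [NormedAddCommGroup F]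
    [NormedSpace ℝ F] {u : E n → F} (hu : MemLp u 2 (volume.restrict Ω)) {χ : E n → ℝ}
    (hχ : Continuous χ) (hχc : HasCompactSupport χ) :
    MemLp (Ω.indicator fun y => χ y • u y) 2 := by
  obtain ⟨B, hB⟩ := hχc.exists_bound_of_continuous hχ
  rw [memLp_indicator_iff_restrict hΩ]
  refine hu.of_le_mul (c := B) (hχ.aestronglyMeasurable.smul hu.1) (ae_of_all _ fun x => ?_)
  rw [norm_smul]
  gcongr
  exact hB x

lemma memLp_clm_apply {χ : E n → ℝ} (hq : MemLp q 2 (volume.restrict Ω)) (hχ : ContDiff ℝ 1 χ)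
    (hχc : HasCompactSupport χ) :
    MemLp (fun y => fderiv ℝ χ y (q y)) 2 (volume.restrict Ω) := by
  have hc := hχ.continuous_fderiv (by norm_num)
  obtain ⟨B, hB⟩ := (hχc.fderiv ℝ).exists_bound_of_continuous hc
  refine hq.of_le_mul (c := B) ?_ (ae_of_all _ fun x => ?_)
  · exact (hc.aestronglyMeasurable.prodMk hq.1 |> fun h =>
      isBoundedBilinearMap_apply.continuous.comp_aestronglyMeasurable h)
  · exact (ContinuousLinearMap.le_opNorm _ _).trans (by gcongr; exact hB x)

lemma memLp_localized_div (hΩ : MeasurableSet Ω) (hq : MemLp q 2 (volume.restrict Ω))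
    (hf : MemLp f 2 (volume.restrict Ω)) {χ : E n → ℝ} (hχ : ContDiff ℝ 1 χ)
    (hχc : HasCompactSupport χ) :
    MemLp (Ω.indicator fun y => χ y * f y + fderiv ℝ χ y (q y)) 2 := by
  rw [memLp_indicator_iff_restrict hΩ]
  have h1 := (memLp_indicator_iff_restrict hΩ).1
    (memLp_smul_indicator hΩ hf hχ.continuous hχc)
  exact h1.add (memLp_clm_apply hq hχ hχc)

/-- The zero extension of `χ q` may have a singular divergence on the boundary. At `x` this is not
seen: by `hx` the function `y ↦ χ y * ψ (x - y)` is supported in `Ω`, hence admissible in the weak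
formulation. Its gradient yields both the derivative of `ψ` and the term with the derivative of `χ`.
-/
lemma tr_fderiv_convolution_localized (hΩ : IsOpen Ω) (hΩb : Bornology.IsBounded Ω)
    (hq : HasWeakDiv Ω q f) {χ ψ : E n → ℝ} (hχ : ContDiff ℝ ∞ χ) (hχc : HasCompactSupport χ)
    (hψ : ContDiff ℝ ∞ ψ) (hψc : HasCompactSupport ψ) {x : E n}
    (hx : ∀ y ∈ tsupport χ, x - y ∈ tsupport ψ → y ∈ Ω) :
    tr (fderiv ℝ (ψ ⋆[ContinuousLinearMap.lsmul ℝ ℝ] Ω.indicator fun y => χ y • q y) x)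
      = (ψ ⋆[ContinuousLinearMap.lsmul ℝ ℝ]
          Ω.indicator fun y => χ y * f y + fderiv ℝ χ y (q y) : E n → ℝ) x := by
  obtain ⟨hqL, hfL, hw⟩ := hq
  have hΩm := hΩ.measurableSet
  have hfin : IsFiniteMeasure (volume.restrict Ω) := ⟨by simpa using hΩb.measure_lt_top⟩
  have hχ1 : ContDiff ℝ 1 χ := hχ.of_le (by norm_cast)
  have hψ1 : ContDiff ℝ 1 ψ := hψ.of_le (by norm_cast)
  have hdχ := hχ1.differentiable (by norm_num)
  have hdψ := hψ1.differentiable (by norm_num)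
  have hφs : tsupport (fun y => χ y * ψ (x - y)) ⊆
      tsupport χ ∩ (fun y => x - y) ⁻¹' tsupport ψ := by
    refine closure_minimal (fun y hy => ?_) ((isClosed_tsupport χ).inter
      ((isClosed_tsupport ψ).preimage (by fun_prop)))
    rw [Function.mem_support] at hy
    exact ⟨subset_tsupport _ (left_ne_zero_of_mul hy),
      subset_tsupport ψ (right_ne_zero_of_mul hy)⟩
  have hweak := hw (fun y => χ y * ψ (x - y)) (hχ.mul (hψ.comp (contDiff_const.sub contDiff_id)))
    (hχc.mul_right) (fun y hy => hx y (hφs hy).1 (hφs hy).2)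
  simp_rw [inner_gradient_right, fderiv_mul_comp_const_sub hdχ hdψ] at hweak
  have hψx : Continuous fun y => ψ (x - y) := hψ.continuous.comp (by fun_prop)
  obtain ⟨B, hB⟩ := hψc.exists_bound_of_continuous hψ.continuous
  have i1 : Integrable (fun y => ψ (x - y) * fderiv ℝ χ y (q y)) (volume.restrict Ω) :=
    ((memLp_clm_apply hqL hχ1 hχc).integrable (by norm_num)).bdd_mul
      hψx.aestronglyMeasurable (ae_of_all _ fun y => hB (x - y))
  have i0 : Integrable (fun y => f y * (χ y * ψ (x - y))) (volume.restrict Ω) := by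
    obtain ⟨B', hB'⟩ := hχc.exists_bound_of_continuous hχ.continuous
    refine (hfL.integrable (by norm_num)).mul_bdd (c := B' * B)
      (hχ.continuous.mul hψx).aestronglyMeasurable (ae_of_all _ fun y => ?_)
    rw [norm_mul]
    exact mul_le_mul (hB' y) (hB _) (norm_nonneg _) ((norm_nonneg _).trans (hB' y))
  have i2 : Integrable (fun y => χ y * fderiv ℝ ψ (x - y) (q y)) (volume.restrict Ω) := by
    have hc : Continuous fun y => χ y • fderiv ℝ ψ (x - y) :=
      hχ.continuous.smul ((hψ1.continuous_fderiv (by norm_num)).comp (by fun_prop))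
    have hcc : HasCompactSupport fun y => χ y • fderiv ℝ ψ (x - y) := hχc.smul_right
    obtain ⟨B', hB'⟩ := hcc.exists_bound_of_continuous hc
    refine ((hqL.integrable (by norm_num)).norm.const_mul B').mono' ?_ (ae_of_all _ fun y => ?_)
    · exact isBoundedBilinearMap_apply.continuous.comp_aestronglyMeasurable
        (hc.aestronglyMeasurable.prodMk hqL.1)
    · exact (((χ y • fderiv ℝ ψ (x - y)).le_opNorm (q y))).trans (by gcongr; exact hB' y)
  rw [integral_sub i1 i2] at hweak
  have hgl := (memLp_smul_indicator hΩm hqL hχ.continuous hχc).locallyIntegrable (by norm_num)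
  rw [tr_fderiv_convolution hψ1 hψc hgl, convolution_lsmul_swap]
  have e1 : ∀ y, fderiv ℝ ψ (x - y) (Ω.indicator (fun y => χ y • q y) y)
      = Ω.indicator (fun y => χ y * fderiv ℝ ψ (x - y) (q y)) y := fun y => by
    simp only [indicator]; split_ifs <;> simp
  have e2 : ∀ y, ψ (x - y) • Ω.indicator (fun y => χ y * f y + fderiv ℝ χ y (q y)) y
      = Ω.indicator (fun y => f y * (χ y * ψ (x - y)) + ψ (x - y) * fderiv ℝ χ y (q y)) y :=
    fun y => by
      simp only [indicator]
      split_ifs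
      · rw [smul_eq_mul]; ring
      · simp
  simp_rw [e1, e2]
  rw [integral_indicator hΩm, integral_indicator hΩm, integral_add i0 i1]
  linarith

/-- Near every point of its closure, a Lipschitz domain is mapped into itself by the translations
close to small multiples of some vector. -/
lemma IsLipschitzDomain.exists_inward (hΩ : IsLipschitzDomain Ω) {x₀ : E n}
    (hx₀ : x₀ ∈ closure Ω) : ∃ e : E n, ∃ r > 0, ∃ c > 0, ∃ τ₀ > 0, ∀ τ, 0 < τ → τ < τ₀ →
      ∀ x ∈ Ω, ∀ y ∈ Metric.ball x₀ r, ‖y - x - τ • e‖ ≤ c * τ → y ∈ Ω := by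
  by_cases h : x₀ ∈ Ω
  · obtain ⟨r, hr, hrΩ⟩ := Metric.isOpen_iff.1 hΩ.isOpen x₀ h
    -- At an interior point a ball lies in `Ω`, and no translation is needed.
    exact ⟨0, r, hr, 1, one_pos, 1, one_pos, fun τ _ _ x _ y hy _ => hrΩ hy⟩
  · have hfr : x₀ ∈ frontier Ω := by
      rw [hΩ.isOpen.frontier_eq]; exact ⟨hx₀, h⟩
    obtain ⟨e, he, g, L, hg, r, hr, H⟩ := hΩ.lipschitz x₀ hfr
    have hL : (0 : ℝ) ≤ L := L.2
    have hden : (0 : ℝ) < 2 * L + 2 := by positivity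
    -- The rise along `e` is at least `τ - cτ`, while the graph rises by at most `2Lcτ`, which is `τ
    -- - 2cτ` for this `c`. As `c ≤ 1`, the points `x` and `y` are at most `2τ < r / 2` apart, so
    -- `x` stays in the chart.
    refine ⟨e, r / 2, by positivity, 1 / (2 * L + 2), by positivity, r / 4, by positivity,
      fun τ hτ hτr x hx y hy hxy => ?_⟩
    set c : ℝ := 1 / (2 * L + 2) with hc
    have hc1 : c ≤ 1 := by
      rw [hc, div_le_one hden]; linarith
    have hcL : c * (2 * L + 2) = 1 := by rw [hc]; field_simp
    have hc0 : 0 < c := by rw [hc]; positivity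
    set d := y - x - τ • e with hd
    have hyx : y = x + τ • e + d := by rw [hd]; abel
    have hyb : y ∈ Metric.ball x₀ r := Metric.ball_subset_ball (by linarith) hy
    have hxb : x ∈ Metric.ball x₀ r := by
      rw [Metric.mem_ball] at hy ⊢
      have h1 : dist x y ≤ τ + c * τ := by
        rw [dist_comm, dist_eq_norm]
        have : y - x = τ • e + d := by rw [hd]; abel
        rw [this]
        refine (norm_add_le _ _).trans (add_le_add ?_ hxy)
        rw [norm_smul, he, mul_one, Real.norm_of_nonneg hτ.le]
      have h2 := dist_triangle x y x₀
      nlinarith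
    have hgx := (H x hxb).1 hx
    rw [H y hyb]
    have hey : inner ℝ e y = inner ℝ e x + τ + inner ℝ e d := by
      rw [hyx, inner_add_right, inner_add_right, inner_smul_right,
        real_inner_self_eq_norm_sq, he]
      ring
    have hed : |inner ℝ e d| ≤ c * τ := by
      refine (abs_real_inner_le_norm _ _).trans ?_
      rw [he, one_mul]; exact hxy
    have hP : ‖(y - inner ℝ e y • e) - (x - inner ℝ e x • e)‖ ≤ 2 * (c * τ) := by
      have : (y - inner ℝ e y • e) - (x - inner ℝ e x • e) = d - inner ℝ e d • e := by
        rw [hey, hd]; module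
      rw [this]
      refine (norm_sub_le _ _).trans ?_
      rw [norm_smul, he, mul_one, Real.norm_eq_abs]
      linarith
    have hgy : g (y - inner ℝ e y • e) ≤ g (x - inner ℝ e x • e) + L * (2 * (c * τ)) := by
      have h1 := hg.dist_le_mul (y - inner ℝ e y • e) (x - inner ℝ e x • e)
      rw [Real.dist_eq, dist_eq_norm] at h1
      have h2 := (le_abs_self _).trans h1
      have h3 := mul_le_mul_of_nonneg_left hP hL
      linarith
    have h4 := (abs_le.1 hed).1
    have h5 : L * (2 * (c * τ)) + 2 * (c * τ) = τ := by
      calc L * (2 * (c * τ)) + 2 * (c * τ) = (c * (2 * L + 2)) * τ := by ring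
        _ = τ := by rw [hcL, one_mul]
    have h6 : 0 < c * τ := by positivity
    refine hgy.trans_lt ?_
    rw [hey]
    linarith

/-- The mollifier is a bump of radius `cτ` centred at `-τe`. For `x` in `Ω` the convolution samples
points within `cτ` of `x + τe`; those in the support of `χ` lie in `Ω` by `hcone`, so mollification
commutes with the divergence there. -/
lemma exists_smooth_approx_localized (hΩ : IsOpen Ω) (hΩb : Bornology.IsBounded Ω)
    (hq : HasWeakDiv Ω q f) {χ : E n → ℝ} (hχ : ContDiff ℝ ∞ χ) (hχc : HasCompactSupport χ)
    {x₀ e : E n} {r c τ₀ : ℝ} (hc : 0 < c) (hτ₀ : 0 < τ₀) (hχr : tsupport χ ⊆ Metric.ball x₀ r)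
    (hcone : ∀ τ, 0 < τ → τ < τ₀ → ∀ x ∈ Ω, ∀ y ∈ Metric.ball x₀ r,
      ‖y - x - τ • e‖ ≤ c * τ → y ∈ Ω) {ε : ℝ≥0∞} (hε : ε ≠ 0) :
    ∃ Q : E n → E n, ContDiff ℝ ∞ Q ∧ HasCompactSupport Q ∧
      eLpNorm (fun x => Q x - χ x • q x) 2 (volume.restrict Ω) ≤ ε ∧
      eLpNorm (fun x => tr (fderiv ℝ Q x) - (χ x * f x + fderiv ℝ χ x (q x))) 2
        (volume.restrict Ω) ≤ ε := by
  have hΩm := hΩ.measurableSet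
  have hχ1 : ContDiff ℝ 1 χ := hχ.of_le (by norm_cast)
  set g : E n → E n := Ω.indicator fun y => χ y • q y with hgdef
  set G : E n → ℝ := Ω.indicator fun y => χ y * f y + fderiv ℝ χ y (q y) with hGdef
  have hg : MemLp g 2 := memLp_smul_indicator hΩm hq.1 hχ.continuous hχc
  have hG : MemLp G 2 := memLp_localized_div hΩm hq.1 hq.2.1 hχ1 hχc
  obtain ⟨ρ₁, hρ₁, h₁⟩ := exists_eLpNorm_translate_sub_le hg hε
  obtain ⟨ρ₂, hρ₂, h₂⟩ := exists_eLpNorm_translate_sub_le hG hε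
  have hpos : 0 < ‖e‖ + c := by positivity
  obtain ⟨τ, hτ, hτlt⟩ := exists_between
    (show 0 < min τ₀ (min ρ₁ ρ₂ / (‖e‖ + c)) from lt_min hτ₀ (div_pos (lt_min hρ₁ hρ₂) hpos))
  have hτ1 : τ < τ₀ := hτlt.trans_le (min_le_left _ _)
  have hτ2 : τ * (‖e‖ + c) < min ρ₁ ρ₂ := by
    rw [← lt_div_iff₀ hpos]; exact hτlt.trans_le (min_le_right _ _)
  let b : ContDiffBump (-(τ • e)) :=
    ⟨c * τ / 2, c * τ, by positivity, by have : 0 < c * τ := by positivity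
                                         linarith⟩
  set ψ : E n → ℝ := b.normed volume with hψdef
  have hψs : Function.support ψ ⊆ Metric.ball 0 (min ρ₁ ρ₂) := by
    rw [hψdef, b.support_normed_eq]
    refine Metric.ball_subset_ball' ?_
    have : dist (-(τ • e)) 0 = τ * ‖e‖ := by
      rw [dist_zero_right, norm_neg, norm_smul, Real.norm_of_nonneg hτ.le]
    rw [this]
    change c * τ + τ * ‖e‖ ≤ _
    linarith
  have hψt : tsupport ψ = Metric.closedBall (-(τ • e)) (c * τ) := b.tsupport_normed_eq
  have hψ : ContDiff ℝ ∞ ψ := b.contDiff_normed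
  have hψc : HasCompactSupport ψ := b.hasCompactSupport_normed
  have hgc : HasCompactSupport g := by
    refine hχc.mono fun x hx => ?_
    contrapose! hx
    rw [Function.notMem_support] at hx ⊢
    simp [hgdef, indicator, hx]
  refine ⟨ψ ⋆[ContinuousLinearMap.lsmul ℝ ℝ] g,
    hψc.contDiff_convolution_left _ hψ (hg.locallyIntegrable (by norm_num)),
    hψc.convolution _ hgc, ?_, ?_⟩
  · have h := eLpNorm_convolution_sub_le hg hψ.continuous hψc b.nonneg_normed b.integral_normed
      (ρ := ρ₁) (hψs.trans (Metric.ball_subset_ball (min_le_left _ _))) h₁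
    refine le_trans (le_trans (le_of_eq (eLpNorm_congr_ae ?_)) (eLpNorm_restrict_le _ _ _ Ω)) h
    filter_upwards [ae_restrict_mem hΩm] with x hx
    simp [hgdef, indicator_of_mem hx]
  · have h := eLpNorm_convolution_sub_le hG hψ.continuous hψc b.nonneg_normed b.integral_normed
      (ρ := ρ₂) (hψs.trans (Metric.ball_subset_ball (min_le_right _ _))) h₂
    refine le_trans (le_trans (le_of_eq (eLpNorm_congr_ae ?_)) (eLpNorm_restrict_le _ _ _ Ω)) h
    filter_upwards [ae_restrict_mem hΩm] with x hx
    rw [hgdef, tr_fderiv_convolution_localized hΩ hΩb hq hχ hχc hψ hψc fun y hy hxy => ?_]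
    · simp [hGdef, indicator_of_mem hx]
    · refine hcone τ hτ hτ1 x hx y (hχr hy) ?_
      rw [hψt, Metric.mem_closedBall, dist_eq_norm] at hxy
      have he : x - y - -(τ • e) = -(y - x - τ • e) := by abel
      rwa [he, norm_neg] at hxy

lemma tr_sum {ι : Type*} (s : Finset ι) (A : ι → E n →L[ℝ] E n) :
    tr (∑ i ∈ s, A i) = ∑ i ∈ s, tr (A i) := by
  simp_rw [← trL_apply]
  exact map_sum trL A s

/-- Smooth compactly supported fields are dense in `H(div, Ω)`. -/
lemma exists_smooth_approx (hΩ : IsLipschitzDomain Ω) (hq : HasWeakDiv Ω q f) {ε : ℝ≥0∞}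
    (hε : ε ≠ 0) :
    ∃ Q : E n → E n, ContDiff ℝ ∞ Q ∧ HasCompactSupport Q ∧
      eLpNorm (fun x => Q x - q x) 2 (volume.restrict Ω) ≤ ε ∧
      eLpNorm (fun x => tr (fderiv ℝ Q x) - f x) 2 (volume.restrict Ω) ≤ ε := by
  have hΩm := hΩ.isOpen.measurableSet
  choose! e r hr c hc τ₀ hτ₀ hcone using fun (x₀ : E n) (hx₀ : x₀ ∈ closure Ω) =>
    hΩ.exists_inward hx₀
  have hcpt : IsCompact (closure Ω) := hΩ.isBounded.isCompact_closure
  obtain ⟨t, htΩ, ht⟩ := hcpt.elim_nhds_subcover (fun x => Metric.ball x (r x))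
    fun x hx => Metric.ball_mem_nhds x (hr x hx)
  obtain ⟨p, hp⟩ := SmoothPartitionOfUnity.exists_isSubordinate (modelWithCornersSelf ℝ (E n))
    hcpt.isClosed (fun i : t => Metric.ball (i : E n) (r i)) (fun i => Metric.isOpen_ball)
    (fun x hx => by
      obtain ⟨i, hi, hxi⟩ := mem_iUnion₂.1 (ht hx)
      exact mem_iUnion.2 ⟨⟨i, hi⟩, hxi⟩)
  have hχ : ∀ i, ContDiff ℝ ∞ (p i) := fun i => (p i).contMDiff.contDiff
  have hχc : ∀ i, HasCompactSupport (p i) := fun i =>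
    (isCompact_closedBall (i : E n) (r i)).of_isClosed_subset (isClosed_tsupport _)
      ((hp i).trans Metric.ball_subset_closedBall)
  have hsum : ∀ x ∈ Ω, ∑ i, p i x = 1 := fun x hx => by
    rw [← finsum_eq_sum_of_fintype]; exact p.sum_eq_one (subset_closure hx)
  -- The extra terms in the divergences of the localized fields `p i • q` cancel in the sum.
  have hdsum : ∀ x ∈ Ω, ∑ i, fderiv ℝ (p i) x = 0 := fun x hx => by
    have h1 : fderiv ℝ (fun y => ∑ i, p i y) x = ∑ i, fderiv ℝ (p i) x :=
      fderiv_fun_sum fun i _ => ((hχ i).differentiable (by norm_num)) x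
    have h2 : (fun y => ∑ i, p i y) =ᶠ[𝓝 x] fun _ => (1 : ℝ) := by
      filter_upwards [hΩ.isOpen.mem_nhds hx] with y hy using hsum y hy
    rw [← h1, h2.fderiv_eq]
    exact fderiv_const_apply _
  set ε' : ℝ≥0∞ := ε / (Fintype.card t + 1) with hε'
  have hε'0 : ε' ≠ 0 := ENNReal.div_ne_zero.2 ⟨hε, by finiteness⟩
  have hcard : (Fintype.card t : ℝ≥0∞) * ε' ≤ ε := by
    calc (Fintype.card t : ℝ≥0∞) * ε' ≤ (Fintype.card t + 1) * ε' := by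
          gcongr; exact le_self_add
      _ ≤ ε := ENNReal.mul_div_le
  choose Q hQ hQc hQ1 hQ2 using fun i : t =>
    exists_smooth_approx_localized hΩ.isOpen hΩ.isBounded hq (hχ i) (hχc i)
      (hc i (htΩ i i.2)) (hτ₀ i (htΩ i i.2)) (hp i) (hcone i (htΩ i i.2)) hε'0
  have hQsum : ContDiff ℝ ∞ fun x => ∑ i, Q i x := ContDiff.sum fun i _ => hQ i
  have hdQ : ∀ i, Differentiable ℝ (Q i) := fun i => (hQ i).differentiable (by norm_num)
  refine ⟨fun x => ∑ i, Q i x, hQsum, ?_, ?_, ?_⟩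
  · have hK : IsCompact (⋃ i, tsupport (Q i)) := isCompact_iUnion fun i => hQc i
    refine HasCompactSupport.intro hK fun x hx => ?_
    refine Finset.sum_eq_zero fun i _ => ?_
    by_contra h
    exact hx (mem_iUnion.2 ⟨i, subset_tsupport _ h⟩)
  · have heq : (fun x => (∑ i, Q i x) - q x) =ᵐ[volume.restrict Ω]
        ∑ i, fun x => Q i x - p i x • q x := by
      filter_upwards [ae_restrict_mem hΩm] with x hx
      rw [Finset.sum_apply, Finset.sum_sub_distrib, ← Finset.sum_smul, hsum x hx, one_smul]
    rw [eLpNorm_congr_ae heq]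
    refine (eLpNorm_sum_le (fun i _ => ?_) (by norm_num)).trans ?_
    · exact (hQ i).continuous.aestronglyMeasurable.sub
        ((hχ i).continuous.aestronglyMeasurable.smul hq.1.1)
    · refine (Finset.sum_le_sum fun i _ => hQ1 i).trans ?_
      simpa using hcard
  · have heq : (fun x => tr (fderiv ℝ (fun x => ∑ i, Q i x) x) - f x) =ᵐ[volume.restrict Ω]
        ∑ i, fun x => tr (fderiv ℝ (Q i) x) - (p i x * f x + fderiv ℝ (p i) x (q x)) := by
      filter_upwards [ae_restrict_mem hΩm] with x hx
      rw [Finset.sum_apply, Finset.sum_sub_distrib, Finset.sum_add_distrib, ← Finset.sum_mul,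
        hsum x hx, one_mul, fderiv_fun_sum fun i _ => hdQ i x, tr_sum]
      have : ∑ i, fderiv ℝ (p i) x (q x) = 0 := by
        have := congrArg (fun A : E n →L[ℝ] ℝ => A (q x)) (hdsum x hx)
        simpa using this
      rw [this, add_zero]
    rw [eLpNorm_congr_ae heq]
    refine (eLpNorm_sum_le (fun i _ => ?_) (by norm_num)).trans ?_
    · have h1 : ∀ {F : Type} [NormedAddCommGroup F] [NormedSpace ℝ F] {u : E n → F},
          ContDiff ℝ ∞ u → ContDiff ℝ 1 u := fun hu => hu.of_le (by norm_cast)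
      have hc1 : Continuous fun x => tr (fderiv ℝ (Q i) x) := by
        simp_rw [← trL_apply]
        exact trL.continuous.comp ((h1 (hQ i)).continuous_fderiv (by norm_num))
      exact hc1.aestronglyMeasurable.sub (((hχ i).continuous.aestronglyMeasurable.mul
        hq.2.1.1).add (memLp_clm_apply hq.1 (h1 (hχ i)) (hχc i)).1)
    · refine (Finset.sum_le_sum fun i _ => hQ2 i).trans ?_
      simpa using hcard

end Density

/-! ### The boundary is a null set -/

section Frontier

variable {Ω : Set (E n)}

/-- Translating a graph along `e` keeps the argument of `g` and changes the height. So infinitely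
many translates by a bounded set of vectors are pairwise disjoint, which is impossible for positive
measure. -/
lemma volume_graph_eq_zero {e : E n} (he : ‖e‖ = 1) {g : E n → ℝ} (hg : Continuous g) :
    volume {x : E n | g (x - inner ℝ e x • e) = inner ℝ e x} = 0 := by
  refine Measure.addHaar_eq_zero_of_disjoint_translates volume
    (fun k : ℕ => (1 / ((k : ℝ) + 1)) • e) ?_ ?_ ?_
  · refine (Metric.isBounded_closedBall (x := (0 : E n)) (r := 1)).subset ?_
    rintro _ ⟨k, rfl⟩
    rw [mem_closedBall_zero_iff, norm_smul, he, mul_one, Real.norm_of_nonneg (by positivity),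
      div_le_one (by positivity)]
    linarith [(Nat.cast_nonneg k : (0 : ℝ) ≤ k)]
  · intro k j hkj
    rw [Function.onFun, Set.disjoint_left]
    intro z hz hz'
    rw [singleton_add, mem_image] at hz hz'
    obtain ⟨x, hx, rfl⟩ := hz
    obtain ⟨y, hy, hxy⟩ := hz'
    set a := 1 / ((k : ℝ) + 1) with ha
    set b := 1 / ((j : ℝ) + 1) with hb
    have hyx : y = x + (a - b) • e := by
      rw [sub_smul, ← sub_eq_zero]
      rw [← sub_eq_zero] at hxy
      rw [← hxy]
      abel
    have hin : inner ℝ e y = inner ℝ e x + (a - b) := by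
      rw [hyx, inner_add_right, inner_smul_right, real_inner_self_eq_norm_sq, he]
      ring
    have hP : y - inner ℝ e y • e = x - inner ℝ e x • e := by
      rw [hin, hyx]; module
    have hab : a = b := by
      have h1 : g (x - inner ℝ e x • e) = inner ℝ e x := hx
      have h2 : g (y - inner ℝ e y • e) = inner ℝ e y := hy
      rw [hP, h1, hin] at h2
      linarith
    rw [ha, hb] at hab
    have hk : (k : ℝ) + 1 ≠ 0 := by positivity
    have hj : (j : ℝ) + 1 ≠ 0 := by positivity
    field_simp at hab
    exact hkj (by exact_mod_cast (add_right_cancel hab).symm)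
  · exact (isClosed_eq (by fun_prop) (by fun_prop)).measurableSet

/-- In a chart, a boundary point is not above the graph since `Ω` is open, and not below it since
the points nearby would miss `Ω`. -/
lemma IsLipschitzDomain.volume_frontier (hΩ : IsLipschitzDomain Ω) :
    volume (frontier Ω) = 0 := by
  refine measure_null_of_locally_null _ fun x₀ hx₀ => ?_
  obtain ⟨e, he, g, L, hg, r, hr, H⟩ := hΩ.lipschitz x₀ hx₀
  refine ⟨frontier Ω ∩ Metric.ball x₀ r,
    inter_mem_nhdsWithin _ (Metric.ball_mem_nhds x₀ hr), ?_⟩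
  refine measure_mono_null ?_ (volume_graph_eq_zero he hg.continuous)
  rintro x ⟨hx, hxb⟩
  rw [hΩ.isOpen.frontier_eq] at hx
  have h1 : inner ℝ e x ≤ g (x - inner ℝ e x • e) := not_lt.1 fun h => hx.2 ((H x hxb).2 h)
  refine le_antisymm (not_lt.1 fun h => ?_) h1
  have ho : IsOpen {y : E n | inner ℝ e y < g (y - inner ℝ e y • e)} := by
    have := hg.continuous
    exact isOpen_lt (by fun_prop) (by fun_prop)
  obtain ⟨y, ⟨hy1, hy2⟩, hyΩ⟩ := mem_closure_iff.1 hx.1 _ (ho.inter Metric.isOpen_ball) ⟨h, hxb⟩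
  exact absurd ((H y hy2).1 hyΩ) (not_lt.2 (le_of_lt hy1))

lemma IsLipschitzDomain.tendsto_volume_thickening (hΩ : IsLipschitzDomain Ω) :
    Tendsto (fun δ => volume.real (Metric.thickening δ Ω)) (𝓝[>] 0) (𝓝 (volume.real Ω)) := by
  have hf : ∀ δ, volume (Metric.thickening δ Ω) ≠ ⊤ := fun δ =>
    hΩ.isBounded.thickening.measure_lt_top.ne
  have h := tendsto_measure_thickening (μ := (volume : Measure (E n))) ⟨1, one_pos, hf 1⟩
  have hcl : volume (closure Ω) = volume Ω := by
    refine le_antisymm ?_ (measure_mono subset_closure)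
    rw [closure_eq_self_union_frontier]
    exact (measure_union_le _ _).trans (by rw [hΩ.volume_frontier, add_zero])
  rw [hcl] at h
  exact (ENNReal.tendsto_toReal hΩ.isBounded.measure_lt_top.ne).comp h

lemma IsLipschitzDomain.tendsto_volume_thickening_diff (hΩ : IsLipschitzDomain Ω) :
    Tendsto (fun δ => volume.real (Metric.thickening δ Ω \ Ω)) (𝓝[>] 0) (𝓝 0) := by
  have h := hΩ.tendsto_volume_thickening.sub_const (volume.real Ω)
  rw [sub_self] at h
  refine h.congr' ?_
  filter_upwards [self_mem_nhdsWithin] with δ hδ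
  exact (measureReal_sdiff (Metric.self_subset_thickening hδ Ω) hΩ.isOpen.measurableSet
    hΩ.isBounded.thickening.measure_lt_top.ne).symm

end Frontier

/-! ### Correction of the divergence and the recovery inequality -/

section Recovery

variable {Ω : Set (E n)} {δ : ℝ} {w f : E n → ℝ} {Q : E n → E n}

lemma continuous_tr_fderiv (hQ : ContDiff ℝ 1 Q) : Continuous fun x => tr (fderiv ℝ Q x) := by
  simp_rw [← trL_apply]
  exact trL.continuous.comp (hQ.continuous_fderiv (by norm_num))

lemma hasCompactSupport_tr_fderiv (hQc : HasCompactSupport Q) :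
    HasCompactSupport fun x => tr (fderiv ℝ Q x) := by
  simp_rw [← trL_apply]
  exact (hQc.fderiv ℝ).comp_left (map_zero trL)

/-- The flux of a smooth field with almost the right divergence can be corrected to a flux with
the right nonlocal divergence. -/
lemma exists_corrected_flux (hn : n ≠ 0) (hΩ : MeasurableSet Ω) (hΩb : Bornology.IsBounded Ω)
    (hδ : 0 < δ) (hw : IsKernel δ w) (hf : MemLp f 2 (volume.restrict Ω))
    (hQ : ContDiff ℝ 1 Q) (hQc : HasCompactSupport Q) {M : NNReal}
    (hM : LipschitzWith M (fderiv ℝ Q)) :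
    ∃ r : E n × E n → ℝ, MemL2Pair Ω δ r ∧
      l2norm (volume.restrict (Metric.thickening δ Ω ×ˢ Metric.thickening δ Ω)) r
        ≤ (l2norm (volume.restrict Ω) (fun x => tr (fderiv ℝ Q x) - f x)
          + M * δ * n * l2norm (volume.restrict Ω) (fun _ => (1 : ℝ))) * (Metric.diam Ω + δ) ∧
      fieldFlux w Q + r ∈ NonlocalFlux Ω δ w f := by
  have hfin : IsFiniteMeasure (volume.restrict Ω) := ⟨by simpa using hΩb.measure_lt_top⟩
  set S := Metric.thickening δ Ω ×ˢ Metric.thickening δ Ω with hS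
  have hpL : MemL2Pair Ω δ (fieldFlux w Q) :=
    (memLp_fieldFlux hn hw hQ.continuous hQc).restrict _
  have hone : MemLp (fun _ : E n => (1 : ℝ)) 2 (volume.restrict Ω) := memLp_const 1
  have hD : MemLp (fun x => tr (fderiv ℝ Q x)) 2 (volume.restrict Ω) :=
    (memLp_two_of_continuous (continuous_tr_fderiv hQ)
      (hasCompactSupport_tr_fderiv hQc)).restrict _
  -- The defect of the divergence: a flux whose pairing with the nonlocal gradient is `L` restores
  -- the divergence `f`.
  let L : gradSpace Ω δ w →ₗ[ℝ] ℝ :=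
    { toFun := fun v => -(∫ x in Ω, f x * (v : E n → ℝ) x)
        - ∫ z in S, fieldFlux w Q z * nonlocalGrad w v z
      map_add' := fun u v => by
        have h1 : ∫ x in Ω, f x * ((u : E n → ℝ) x + (v : E n → ℝ) x)
            = (∫ x in Ω, f x * (u : E n → ℝ) x) + ∫ x in Ω, f x * (v : E n → ℝ) x := by
          simp_rw [mul_add]
          exact integral_add (hf.integrable_mul u.2.1) (hf.integrable_mul v.2.1)
        have h2 : ∫ z in S, fieldFlux w Q z * (nonlocalGrad w u z + nonlocalGrad w v z)
            = (∫ z in S, fieldFlux w Q z * nonlocalGrad w u z)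
              + ∫ z in S, fieldFlux w Q z * nonlocalGrad w v z := by
          simp_rw [mul_add]
          exact integral_add (MemLp.integrable_mul hpL u.2.2.2)
            (MemLp.integrable_mul hpL v.2.2.2)
        simp only [Submodule.coe_add, nonlocalGrad_add, Pi.add_apply]
        rw [h1, h2]
        ring
      map_smul' := fun c v => by
        simp only [Submodule.coe_smul, nonlocalGrad_smul, Pi.smul_apply, smul_eq_mul,
          RingHom.id_apply, mul_left_comm _ c]
        rw [integral_const_mul, integral_const_mul]
        ring }
  have hL : ∀ v : gradSpace Ω δ w, |L v|
      ≤ (l2norm (volume.restrict Ω) (fun x => tr (fderiv ℝ Q x) - f x)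
          + M * δ * n * l2norm (volume.restrict Ω) (fun _ => (1 : ℝ)))
        * l2norm volume (v : E n → ℝ) := by
    rintro ⟨v, hv⟩
    have hvL : l2norm (volume.restrict Ω) v = l2norm volume v := by
      rw [l2norm, ← eLpNorm_indicator_eq_eLpNorm_restrict hΩ, Set.indicator_eq_self.2, l2norm]
      intro x hx
      by_contra h
      exact hx (hv.2.1 x h)
    have hset : ∀ u : E n → ℝ, (∀ x, x ∉ Ω → u x = 0) → ∫ x, u x = ∫ x in Ω, u x := fun u hu =>
      (setIntegral_eq_integral_of_forall_compl_eq_zero hu).symm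
    have hvi : Integrable v := by
      have := (integrable_indicator_iff hΩ).2 (hv.1.integrable (by norm_num))
      rwa [Set.indicator_eq_self.2 fun x hx => by
        by_contra h
        exact hx (hv.2.1 x h)] at this
    have h1 := abs_integral_fieldFlux_mul_grad_add_le hn hΩ hw hv hvi hQ hQc hM
    have h2 : ∫ x, |v x| ≤ l2norm (volume.restrict Ω) (fun _ => (1 : ℝ)) * l2norm volume v := by
      rw [hset _ fun x hx => by rw [hv.2.1 x hx, abs_zero]]
      have hva : MemLp (fun x => |v x|) 2 (volume.restrict Ω) := hv.1.norm
      have := (le_abs_self _).trans (abs_integral_mul_le_l2norm hone hva)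
      simp only [one_mul] at this
      have he : l2norm (volume.restrict Ω) (fun x => |v x|) = l2norm (volume.restrict Ω) v :=
        congrArg ENNReal.toReal (eLpNorm_norm v)
      rwa [he, hvL] at this
    have h3 := abs_integral_mul_le_l2norm (hD.sub hf) hv.1
    rw [hvL] at h3
    -- Inserting `div Q` splits the defect into the approximation error of `f` and the nonlocal
    -- consistency error.
    have h4 : L ⟨v, hv⟩ = (∫ x in Ω, ((fun x => tr (fderiv ℝ Q x)) - f) x * v x)
        - ((∫ z in S, fieldFlux w Q z * nonlocalGrad w v z)
          + ∫ x, tr (fderiv ℝ Q x) * v x) := by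
      rw [hset (fun x => tr (fderiv ℝ Q x) * v x) fun x hx => by rw [hv.2.1 x hx, mul_zero]]
      simp only [Pi.sub_apply, sub_mul]
      have i1 : Integrable (fun x => tr (fderiv ℝ Q x) * v x) (volume.restrict Ω) :=
        hD.integrable_mul hv.1
      have i2 : Integrable (fun x => f x * v x) (volume.restrict Ω) := hf.integrable_mul hv.1
      rw [integral_sub i1 i2]
      change -(∫ x in Ω, f x * v x) - (∫ z in S, fieldFlux w Q z * nonlocalGrad w v z) = _
      ring
    rw [h4]
    refine (abs_sub _ _).trans ?_
    rw [add_mul]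
    refine add_le_add h3 (h1.trans ?_)
    rw [mul_assoc _ (l2norm _ _)]
    exact mul_le_mul_of_nonneg_left h2 (by positivity)
  have hK : 0 ≤ l2norm (volume.restrict Ω) (fun x => tr (fderiv ℝ Q x) - f x)
      + M * δ * n * l2norm (volume.restrict Ω) (fun _ : E n => (1 : ℝ)) := by
    have h1 := l2norm_nonneg (μ := volume.restrict Ω) (fun x => tr (fderiv ℝ Q x) - f x)
    have h2 := l2norm_nonneg (μ := volume.restrict Ω) (fun _ : E n => (1 : ℝ))
    positivity
  obtain ⟨r, hr, hrn, hrL⟩ := exists_flux_of_functional hn hΩ hΩb hδ hw L hK hL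
  refine ⟨r, hr, hrn, MemLp.add hpL hr, hf, fun v hv => ?_⟩
  have h1 := hrL ⟨v, hv⟩
  have h2 : ∫ z in S, (fieldFlux w Q + r) z * nonlocalGrad w v z
      = (∫ z in S, fieldFlux w Q z * nonlocalGrad w v z) + ∫ z in S, r z * nonlocalGrad w v z := by
    simp only [Pi.add_apply, add_mul]
    exact integral_add (MemLp.integrable_mul hpL hv.2.2) (MemLp.integrable_mul hr hv.2.2)
  rw [h2, h1]
  change _ = -(_ + (-(∫ x in Ω, f x * v x) - ∫ z in S, fieldFlux w Q z * nonlocalGrad w v z))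
  ring

lemma nonlocalFlux_nonempty (hn : n ≠ 0) (hΩ : MeasurableSet Ω) (hΩb : Bornology.IsBounded Ω)
    (hδ : 0 < δ) (hw : IsKernel δ w) (hf : MemLp f 2 (volume.restrict Ω)) :
    (NonlocalFlux Ω δ w f).Nonempty := by
  obtain ⟨r, -, -, h⟩ := exists_corrected_flux (Q := fun _ => 0) (M := 0) hn hΩ hΩb hδ hw hf
    contDiff_const HasCompactSupport.zero (by
      have : fderiv ℝ (fun _ : E n => (0 : E n)) = fun _ => 0 := by ext; simp
      rw [this]; exact LipschitzWith.const _)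
  exact ⟨_, h⟩

lemma localEnergy_le_of_approx {κ : E n → ℝ} {κmin κmax γ : ℝ} (hκmin : 0 < κmin)
    (hκ : κ ∈ Adm Ω κmin κmax γ) {q : E n → E n} (hq : MemLp q 2 (volume.restrict Ω))
    (hQ : MemLp Q 2 (volume.restrict Ω)) {η : ℝ} (hη : 0 < η) :
    localEnergy Ω κ Q ≤ (1 + η) * localEnergy Ω κ q + (1 / 2) * ((1 + η⁻¹) *
      (κmin⁻¹ * l2norm (volume.restrict Ω) (fun x => Q x - q x) ^ 2)) := by
  have hm : AEStronglyMeasurable (fun x => (κ x)⁻¹) (volume.restrict Ω) :=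
    hκ.1.1.aemeasurable.inv.aestronglyMeasurable
  have hB : ∀ᵐ x ∂volume.restrict Ω, (κ x)⁻¹ ∈ Icc 0 κmin⁻¹ := by
    filter_upwards [hκ.2.1] with x hx
    exact ⟨inv_nonneg.2 (hκmin.le.trans hx.1), inv_anti₀ hκmin hx.1⟩
  have h := integral_weighted_sq_add_le hm hB hq (hQ.sub hq) hη
  simp only [Pi.sub_apply, add_sub_cancel] at h
  have he : l2norm (volume.restrict Ω) (Q - q) = l2norm (volume.restrict Ω) fun x => Q x - q x :=
    rfl
  rw [he] at h
  unfold localEnergy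
  linarith

lemma nonlocalEnergy_add_le {κ : E n → ℝ} {κmin κmax : ℝ} (hκmin : 0 < κmin)
    (hκm : AEStronglyMeasurable κ (volume.restrict (Metric.thickening δ Ω)))
    (hκ : ∀ᵐ x ∂volume.restrict (Metric.thickening δ Ω), κ x ∈ Icc κmin κmax)
    {p r : E n × E n → ℝ} (hp : MemL2Pair Ω δ p) (hr : MemL2Pair Ω δ r) {η : ℝ} (hη : 0 < η) :
    nonlocalEnergy Ω δ (harmonicAvg κ) (p + r)
      ≤ (1 + η) * nonlocalEnergy Ω δ (harmonicAvg κ) p + (1 / 2) * ((1 + η⁻¹) * (κmin⁻¹ *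
        l2norm (volume.restrict (Metric.thickening δ Ω ×ˢ Metric.thickening δ Ω)) r ^ 2)) := by
  have h := integral_weighted_sq_add_le (aestronglyMeasurable_inv_harmonicAvg hκm)
    (ae_inv_harmonicAvg_mem_Icc hκmin hκ) hp hr hη
  simp only [Real.norm_eq_abs, sq_abs] at h
  unfold nonlocalEnergy
  simp only [Pi.add_apply]
  linarith

/-- The recovery inequality. -/
lemma eventually_exists_flux (hn : n ≠ 0) (hΩ : IsLipschitzDomain Ω) {κmin κmax γ : ℝ}
    (hκmin : 0 < κmin) {w : ℝ → E n → ℝ} (hw : ∀ δ > 0, IsKernel δ (w δ)) {δ' : ℝ} (hδ' : 0 < δ')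
    {κ : E n → ℝ} (hκ : κ ∈ NonlocalAdm Ω δ' κmin κmax γ) {q : E n → E n}
    (hq : q ∈ LocalFlux Ω f) {ε : ℝ} (hε : 0 < ε) :
    ∀ᶠ δ in 𝓝[>] (0 : ℝ), ∃ p ∈ NonlocalFlux Ω δ (w δ) f,
      nonlocalEnergy Ω δ (harmonicAvg κ) p ≤ localEnergy Ω κ q + ε := by
  have hΩm := hΩ.isOpen.measurableSet
  set X := localEnergy Ω κ q with hX
  -- Young's inequality is used twice, for passing from `q` to `Q` and for adding the correction;
  -- hence two factors `1 + η`. The parameters are fixed in the order `η`, `σ`, `Q`, and `δ` tends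
  -- to 0 last.
  obtain ⟨η, hη1, hη⟩ : ∃ η : ℝ, (1 + η) * ((1 + η) * X) < X + ε ∧ 0 < η := by
    have hc : Tendsto (fun η : ℝ => (1 + η) * ((1 + η) * X)) (𝓝[>] 0) (𝓝 X) := by
      have : Continuous fun η : ℝ => (1 + η) * ((1 + η) * X) := by fun_prop
      simpa using (this.tendsto 0).mono_left nhdsWithin_le_nhds
    exact ((hc.eventually (gt_mem_nhds (by linarith))).and self_mem_nhdsWithin).exists
  set A := (1 / 2) * ((1 + η⁻¹) * κmin⁻¹) with hA
  have hA0 : 0 ≤ A := by positivity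
  set D := Metric.diam Ω with hD
  have hD0 : 0 ≤ D := Metric.diam_nonneg
  -- Here `σ` bounds the `H(div)` error of `Q`, and `A * (σ * D) ^ 2` is the limit of the bound on
  -- the correction's contribution as `δ` tends to 0.
  obtain ⟨σ, hσ1, hσ⟩ : ∃ σ : ℝ, (1 + η) * ((1 + η) * X + A * σ ^ 2) + A * (σ * D) ^ 2 < X + ε
      ∧ 0 < σ := by
    have hc : Tendsto (fun σ : ℝ => (1 + η) * ((1 + η) * X + A * σ ^ 2) + A * (σ * D) ^ 2)
        (𝓝[>] 0) (𝓝 ((1 + η) * ((1 + η) * X))) := by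
      have : Continuous fun σ : ℝ => (1 + η) * ((1 + η) * X + A * σ ^ 2) + A * (σ * D) ^ 2 := by
        fun_prop
      simpa using (this.tendsto 0).mono_left nhdsWithin_le_nhds
    exact ((hc.eventually (gt_mem_nhds hη1)).and self_mem_nhdsWithin).exists
  obtain ⟨Q, hQ, hQc, hQq, hQf⟩ := exists_smooth_approx hΩ hq
    (ε := ENNReal.ofReal σ) (by simpa using hσ)
  have hQ1 : ContDiff ℝ 1 Q := hQ.of_le (by norm_cast)
  have hl : ∀ {F : Type} [NormedAddCommGroup F] {u : E n → F},
      eLpNorm u 2 (volume.restrict Ω) ≤ ENNReal.ofReal σ → l2norm (volume.restrict Ω) u ≤ σ :=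
    fun h => by
      have := ENNReal.toReal_mono ENNReal.ofReal_ne_top h
      rwa [ENNReal.toReal_ofReal hσ.le] at this
  have hQL : MemLp Q 2 (volume.restrict Ω) :=
    (memLp_two_of_continuous hQ.continuous hQc).restrict _
  obtain ⟨M₀, hM₀⟩ := hQc.exists_bound_of_continuous hQ.continuous
  obtain ⟨M₁, hM₁⟩ := hQ.lipschitzWith_of_hasCompactSupport hQc (by simp)
  obtain ⟨M, hM⟩ := (hQ.fderiv_right (m := ∞) (by norm_cast)).lipschitzWith_of_hasCompactSupport
    (hQc.fderiv ℝ) (by simp)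
  have hM₀0 : 0 ≤ M₀ := (norm_nonneg _).trans (hM₀ 0)
  set V := l2norm (volume.restrict Ω) (fun _ : E n => (1 : ℝ)) with hV
  have hV0 : 0 ≤ V := l2norm_nonneg _
  have hlocQ : localEnergy Ω κ Q ≤ (1 + η) * X + A * σ ^ 2 := by
    have h := localEnergy_le_of_approx hκmin hκ.2.1 hq.1 hQL hη
    have h2 : l2norm (volume.restrict Ω) (fun x => Q x - q x) ^ 2 ≤ σ ^ 2 :=
      pow_le_pow_left₀ (l2norm_nonneg _) (hl hQq) 2
    calc _ ≤ _ := h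
      _ = (1 + η) * X + A * l2norm (volume.restrict Ω) (fun x => Q x - q x) ^ 2 := by
        rw [hA]; ring
      _ ≤ _ := by gcongr
  set R : ℝ → ℝ := fun δ => (1 / 2) * (M₀ ^ 2 * κmin⁻¹ *
    volume.real (Metric.thickening δ Ω \ Ω)
      + M₀ * M₁ * δ * (n * (κmin⁻¹ * volume.real (Metric.thickening δ Ω)))) with hR
  have hid : Tendsto (fun δ : ℝ => δ) (𝓝[>] 0) (𝓝 0) :=
    tendsto_id.mono_left nhdsWithin_le_nhds
  have hR0 : Tendsto R (𝓝[>] 0) (𝓝 0) := by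
    have h := ((hΩ.tendsto_volume_thickening_diff.const_mul (M₀ ^ 2 * κmin⁻¹)).add
      ((hid.const_mul (M₀ * M₁)).mul
        ((hΩ.tendsto_volume_thickening.const_mul κmin⁻¹).const_mul (n : ℝ)))).const_mul (1 / 2)
    simp only [mul_zero, zero_mul, add_zero] at h
    exact h
  have hlim : Tendsto (fun δ : ℝ => (1 + η) * ((1 + η) * X + A * σ ^ 2 + R δ)
      + A * ((σ + M * δ * n * V) * (D + δ)) ^ 2) (𝓝[>] 0)
      (𝓝 ((1 + η) * ((1 + η) * X + A * σ ^ 2) + A * (σ * D) ^ 2)) := by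
    have h := ((hR0.const_add ((1 + η) * X + A * σ ^ 2)).const_mul (1 + η)).add
      ((((((((hid.const_mul (M : ℝ)).mul_const (n : ℝ)).mul_const V)).const_add σ).mul
        (hid.const_add D)).pow 2).const_mul A)
    simpa using h
  filter_upwards [hlim.eventually (gt_mem_nhds hσ1), self_mem_nhdsWithin,
    Ioo_mem_nhdsGT hδ'] with δ hlt hδ hδδ
  have hδ0 : 0 < δ := hδ
  have hκm := aestronglyMeasurable_of_mem_nonlocalAdm hκ hδδ.2.le
  have hκI := ae_mem_Icc_of_mem_nonlocalAdm hκ hδδ.2.le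
  obtain ⟨r, hr, hrn, hp⟩ := exists_corrected_flux hn hΩm hΩ.isBounded hδ (hw δ hδ) hq.2.1 hQ1
    hQc hM
  refine ⟨_, hp, ?_⟩
  have hpL : MemL2Pair Ω δ (fieldFlux (w δ) Q) :=
    (memLp_fieldFlux hn (hw δ hδ) hQ.continuous hQc).restrict _
  have h1 := nonlocalEnergy_add_le hκmin hκm hκI hpL hr hη
  have h2 := nonlocalEnergy_fieldFlux_le_localEnergy hn hΩm hΩ.isBounded hδ (hw δ hδ) hκmin hκm
    hκI hQ.continuous hQc hM₀ M₁.2 (fun x y => by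
      have := hM₁.dist_le_mul x y
      rwa [dist_eq_norm, dist_eq_norm] at this)
  have h3 : l2norm (volume.restrict (Metric.thickening δ Ω ×ˢ Metric.thickening δ Ω)) r
      ≤ (σ + M * δ * n * V) * (D + δ) := by
    refine hrn.trans ?_
    have := hl hQf
    gcongr
  have h4 : l2norm (volume.restrict (Metric.thickening δ Ω ×ˢ Metric.thickening δ Ω)) r ^ 2
      ≤ ((σ + M * δ * n * V) * (D + δ)) ^ 2 := pow_le_pow_left₀ (l2norm_nonneg _) h3 2
  refine le_trans ?_ hlt.le
  calc _ ≤ _ := h1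
    _ = (1 + η) * nonlocalEnergy Ω δ (harmonicAvg κ) (fieldFlux (w δ) Q) + A *
        l2norm (volume.restrict (Metric.thickening δ Ω ×ˢ Metric.thickening δ Ω)) r ^ 2 := by
      rw [hA]; ring
    _ ≤ _ := by
      gcongr
      exact h2.trans (add_le_add hlocQ le_rfl)

/-- Extending an admissible conductivity by the lower bound. -/
lemma exists_nonlocalAdm_extension (hΩ : MeasurableSet Ω) {κ : E n → ℝ} {κmin κmax γ : ℝ}
    (hκle : κmin ≤ κmax) (hκ : κ ∈ Adm Ω κmin κmax γ) :
    ∃ κ' : E n → ℝ, (∀ δ, κ' ∈ NonlocalAdm Ω δ κmin κmax γ) ∧ EqOn κ' κ Ω := by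
  classical
  set κ' : E n → ℝ := Ω.piecewise κ fun _ => κmin with hκ'
  have heq : EqOn κ' κ Ω := fun x hx => Set.piecewise_eq_of_mem _ _ _ hx
  have heqc : EqOn κ' (fun _ => κmin) Ωᶜ := fun x hx => Set.piecewise_eq_of_notMem _ _ _ hx
  have hae : κ' =ᵐ[volume.restrict Ω] κ := by
    filter_upwards [ae_restrict_mem hΩ] with x hx using heq hx
  have hI : ∀ᵐ x ∂volume.restrict Ω, κ' x ∈ Icc κmin κmax := by
    filter_upwards [hae, hκ.2.1] with x h1 h2
    rwa [h1]
  have hIall : ∀ᵐ x, κ' x ∈ Icc κmin κmax := by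
    filter_upwards [(ae_restrict_iff' hΩ).1 hI] with x hx
    by_cases h : x ∈ Ω
    · exact hx h
    · rw [heqc h]; exact ⟨le_rfl, hκle⟩
  have hm : AEStronglyMeasurable κ' :=
    AEStronglyMeasurable.piecewise hΩ hκ.1.1 aestronglyMeasurable_const
  refine ⟨κ', fun δ => ⟨?_, ⟨hκ.1.ae_eq hae.symm, hI, ?_⟩, ae_restrict_of_ae hIall⟩, heq⟩
  · refine memLp_top_of_bound hm.restrict (max |κmin| |κmax|) (ae_restrict_of_ae ?_)
    filter_upwards [hIall] with x hx
    exact abs_le_max_abs_abs hx.1 hx.2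
  · rw [integral_congr_ae hae]; exact hκ.2.2

end Recovery

lemma limsup_le_of_forall_pos_eventually_le {l : Filter ℝ} {u : ℝ → EReal} {a : ℝ}
    (h : ∀ ε > 0, ∀ᶠ x in l, u x ≤ ((a + ε : ℝ) : EReal)) : limsup u l ≤ (a : EReal) := by
  refine le_of_forall_gt_imp_ge_of_dense fun b hb => ?_
  obtain ⟨c, hac, hcb⟩ := EReal.lt_iff_exists_real_btwn.1 hb
  have hac' : a < c := by exact_mod_cast hac
  have := limsup_le_of_le (f := l) (by isBoundedDefault) (h (c - a) (by linarith))
  rw [add_sub_cancel] at this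
  exact this.trans hcb.le

end NonlocalDesign

end

/-! ### Conclusion -/

open NonlocalDesign
theorem mainTheorem5 {n : ℕ} (hn : 2 ≤ n) (Ω : Set (E n)) (hΩ : IsLipschitzDomain Ω)
    (κmin κmax γ : ℝ) (hκmin : 0 < κmin) (hκ : κmin < κmax) (hγ : γ ∈ Set.Ioo κmin κmax)
    (w : ℝ → E n → ℝ) (hw : ∀ δ > 0, IsKernel δ (w δ))
    (f : E n → ℝ) (hf : MemLp f 2 (volume.restrict Ω)) :
    (∀ δbar > 0, ∀ κ ∈ NonlocalAdm Ω δbar κmin κmax γ, ∀ q ∈ LocalFlux Ω f,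
      ∃ p : ℝ → E n × E n → ℝ,
        (∀ δ > 0, p δ ∈ NonlocalFlux Ω δ (w δ) f) ∧
        Filter.limsup (fun δ => (nonlocalEnergy Ω δ (harmonicAvg κ) (p δ) : EReal)) (𝓝[>] 0)
          ≤ (localEnergy Ω κ q : EReal)) ∧
    Filter.limsup (fun δ => nonlocalValue Ω δ (w δ) κmin κmax γ f) (𝓝[>] 0)
      ≤ localValue Ω κmin κmax γ f := by
  have hn0 : n ≠ 0 := by omega
  have hΩm := hΩ.isOpen.measurableSet
  refine ⟨fun δbar hδbar κ hκa q hq => ?_, ?_⟩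
  -- The fluxes of `eventually_exists_flux` depend on `ε`. A single family serving all `ε` consists
  -- of minimisers up to `δ`, which do at least as well up to that error.
  · have hex : ∀ δ : ℝ, ∃ p : E n × E n → ℝ, 0 < δ → p ∈ NonlocalFlux Ω δ (w δ) f ∧
        nonlocalEnergy Ω δ (harmonicAvg κ) p
          < sInf (nonlocalEnergy Ω δ (harmonicAvg κ) '' NonlocalFlux Ω δ (w δ) f) + δ := by
      intro δ
      by_cases hδ : 0 < δ
      · obtain ⟨_, ⟨p, hp, rfl⟩, hlt⟩ := Real.lt_sInf_add_pos
          ((nonlocalFlux_nonempty hn0 hΩm hΩ.isBounded hδ (hw δ hδ) hf).image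
            (nonlocalEnergy Ω δ (harmonicAvg κ))) hδ
        exact ⟨p, fun _ => ⟨hp, hlt⟩⟩
      · exact ⟨0, fun h => absurd h hδ⟩
    choose p hp using hex
    refine ⟨p, fun δ hδ => (hp δ hδ).1, limsup_le_of_forall_pos_eventually_le fun ε hε => ?_⟩
    filter_upwards [eventually_exists_flux hn0 hΩ hκmin hw hδbar hκa hq (half_pos hε),
      self_mem_nhdsWithin, Ioo_mem_nhdsGT hδbar, Ioo_mem_nhdsGT (half_pos hε)]
      with δ ⟨p', hp', hle⟩ hδ hδ1 hδ2
    have hbdd : BddBelow (nonlocalEnergy Ω δ (harmonicAvg κ) '' NonlocalFlux Ω δ (w δ) f) := by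
      refine ⟨0, ?_⟩
      rintro _ ⟨p, -, rfl⟩
      exact nonlocalEnergy_nonneg hκmin (ae_mem_Icc_of_mem_nonlocalAdm hκa hδ1.2.le) p
    have h1 := (hp δ hδ).2
    have h2 := csInf_le hbdd (Set.mem_image_of_mem _ hp')
    rw [EReal.coe_le_coe_iff]
    linarith [hδ2.2]
  · refine le_iInf₂ fun κ hκa => le_iInf₂ fun q hq => ?_
    -- A local conductivity carries no bounds outside `Ω`; one extension admissible for every `δ`
    -- has the same local energy.
    obtain ⟨κ', hκ', heq⟩ := exists_nonlocalAdm_extension hΩm hκ.le hκa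
    have hloc : localEnergy Ω κ' q = localEnergy Ω κ q := by
      unfold localEnergy
      rw [setIntegral_congr_fun (g := fun x => (κ x)⁻¹ * ‖q x‖ ^ 2) hΩm fun x hx => by
        simp only [heq hx]]
    rw [← hloc]
    refine limsup_le_of_forall_pos_eventually_le fun ε hε => ?_
    filter_upwards [eventually_exists_flux hn0 hΩ hκmin hw one_pos (hκ' 1) hq hε]
      with δ ⟨p, hp, hle⟩
    refine (iInf₂_le κ' (hκ' δ)).trans ((iInf₂_le p hp).trans ?_)
    exact_mod_cast hle
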